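/- **Theorem 3.1.** A *variety of groups* is a class of groups closed under taking subgroups, homomorphic images and arbitrary direct products; a *pseudovariety* is a class of finite groups closed under taking subgroups, homomorphic images and finitary direct products. For a pseudovariety $\mathbf W$ and a group $G$, the *pro-$\mathbf W$ topology* on $G$ is the coarsest topology for which all homomorphisms from $G$ into (discrete) groups of $\mathbf W$ are continuous, and $\mathrm{Cl}^G_{\mathbf W}(S)$ denotes the closure of $S\subseteq G$ in this topology; $\mathbf G$ is the pseudovariety of all finite groups, so that the pro-$\mathbf G$ topology is the profinite topology. A pseudovariety is *decidable* if there is an algorithm which, given the multiplication table of a finite group, decides whether that group belongs to it. For a variety $\mathcal V$ let $\mathcal V^f=\mathcal V\cap\mathbf G$. For a set $A$ let $F_A$ be the free group on $A$, let $F_A^{\mathcal V}\trianglelefteq F_A$ be the normal closure of all elements $\varphi(u)$, where $u$ runs through the elements of the free group $F_X$ on a countably infinite set $X$ that are identities of $\mathcal V$ (any set of identities defining $\mathcal V$ gives the same subgroup) and $\varphi$ through the homomorphisms $F_X\to F_A$, and let $\pi_{\mathcal V}:F_A\to F_A/F_A^{\mathcal V}$ be the canonical homomorphism. Let $\mathcal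 V$ be a variety of groups, $A$ a set, and $H$ a finitely generated subgroup of $F_A$. Then: 1. $\mathrm{Cl}^{F_A}_{\mathcal V^f}(H)=\pi_{\mathcal V}^{-1}\big(\mathrm{Cl}^{F_A/F_A^{\mathcal V}}_{\mathbf G}(\pi_{\mathcal V}(H))\big)\ \ge\ HF_A^{\mathcal V}$. 2. If $A$ is infinite, then $\mathrm{Cl}^{F_A}_{\mathcal V^f}(H)$ is finitely generated if and only if $\mathcal V$ is the variety of all groups. 3. If $A$ is finite, then, except in the case where $|A|=1$, $H=1$, $F_A^{\mathcal V}=1$ and $\mathcal V$ is not the variety of all groups, $\mathrm{Cl}^{F_A}_{\mathcal V^f}(H)$ is finitely generated if and only if $\mathcal V$ is the variety of all groups or $\mathrm{Cl}^{F_A}_{\mathcal V^f}(H)$ has finite index in $F_A$. 4. If $\mathcal V^f$ is a decidable pseudovariety, then it is decidable whether or not $H$ is $\mathcal V^f$-closed. Precisely: there is a single algorithm which, given $n\in\mathbb N$ and a finite list of group words in $n$ letters, decides whether the subgroup they generate in the free group on any $n$-element alphabet is $\mathcal V^f$-closed; and if $A$ is infinite, then for every sequence $a_0,a_1,\dots$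 of distinct letters of $A$ there is an algorithm which, given a finite list of group words in these letters, decides whether the subgroup of $F_A$ that they generate is $\mathcal V^f$-closed. -/

import Mathlib

open scoped Pointwise

universe u

/-- A variety of groups: a class of groups closed under taking subgroups, homomorphic images and
arbitrary direct products. -/
structure GroupVariety where
  Mem : (G : Type u) → [Group G] → Prop
  subgroup_mem : ∀ (G : Type u) [Group G], Mem G → ∀ H : Subgroup G, Mem H
  image_mem : ∀ (G K : Type u) [Group G] [Group K] (f : G →* K),
    Function.Surjective f → Mem G → Mem K
  pi_mem : ∀ (ι : Type u) (G : ι → Type u) [∀ i, Group (G i)], (∀ i, Mem (G i)) → Mem (∀ i, G i)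

/-- A pseudovariety of finite groups: a class of finite groups closed under taking subgroups,
homomorphic images and finitary direct products. -/
structure GroupPseudovariety where
  Mem : (G : Type u) → [Group G] → Prop
  finite_of_mem : ∀ (G : Type u) [Group G], Mem G → Finite G
  subgroup_mem : ∀ (G : Type u) [Group G], Mem G → ∀ H : Subgroup G, Mem H
  image_mem : ∀ (G K : Type u) [Group G] [Group K] (f : G →* K),
    Function.Surjective f → Mem G → Mem K
  pi_mem : ∀ (ι : Type u) [Finite ι] (G : ι → Type u) [∀ i, Group (G i)],
    (∀ i, Mem (G i)) → Mem (∀ i, G i)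

namespace GroupPseudovariety

/-- The pseudovariety of all finite groups. -/
def allFinite : GroupPseudovariety.{u} where
  Mem G _ := Finite G
  finite_of_mem _ _ h := h
  subgroup_mem G _ h H := by
    have : Finite G := h
    exact inferInstance
  image_mem G K _ _ f hf h := by
    have : Finite G := h
    exact Finite.of_surjective f hf
  pi_mem ι _ G _ h := by
    have : ∀ i, Finite (G i) := h
    exact inferInstance

/-- The pro-`W` topology on a group `G`: the coarsest topology for which every homomorphism from
`G` to a (discrete) group belonging to `W` is continuous. -/
@[reducible]
def topology (W : GroupPseudovariety.{u}) (G : Type u) [Group G] : TopologicalSpace G :=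
  ⨅ (K : Type u) (_ : Group K) (_ : W.Mem K) (f : G →* K), TopologicalSpace.induced f ⊥

theorem isTopologicalGroup (W : GroupPseudovariety.{u}) (G : Type u) [Group G] :
    @IsTopologicalGroup G (W.topology G) _ := by
  refine topologicalGroup_iInf fun K => topologicalGroup_iInf fun _ =>
    topologicalGroup_iInf fun _ => topologicalGroup_iInf fun f => ?_
  let _ : TopologicalSpace K := ⊥
  have : DiscreteTopology K := ⟨rfl⟩
  exact topologicalGroup_induced f

/-- The closure of a subgroup for the pro-`W` topology (again a subgroup). -/
def closure (W : GroupPseudovariety.{u}) {G : Type u} [Group G] (H : Subgroup G) : Subgroup G :=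
  letI := W.topology G
  haveI := W.isTopologicalGroup G
  H.topologicalClosure

/-- The subgroup `H` is closed for the pro-`W` topology. -/
def IsClosedSubgroup (W : GroupPseudovariety.{u}) {G : Type u} [Group G] (H : Subgroup G) : Prop :=
  @IsClosed G (W.topology G) (H : Set G)

/-- The list of rows `M` is a multiplication table of the group `G`, for some enumeration of the
elements of `G`. -/
def IsMulTable (M : List (List ℕ)) (G : Type u) [Group G] : Prop :=
  (∀ r ∈ M, r.length = M.length) ∧
    ∃ e : G ≃ Fin M.length, ∀ a b : G,
      (M[(e a : ℕ)]?.bind fun r => r[(e b : ℕ)]?) = some (e (a * b) : ℕ)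

/-- The membership problem of `W` is decidable: there is an algorithm that, given a multiplication
table of a finite group, decides whether the group belongs to `W`. -/
def IsDecidable (W : GroupPseudovariety.{u}) : Prop :=
  ComputablePred fun M : List (List ℕ) => ∃ (G : Type u) (_ : Group G), IsMulTable M G ∧ W.Mem G

end GroupPseudovariety

/-- `G` satisfies the group identity `w`, a word in countably many variables. -/
def SatisfiesIdentity (G : Type u) [Group G] (w : FreeGroup ℕ) : Prop :=
  ∀ φ : FreeGroup ℕ →* G, φ w = 1

/-- The normal closure in `F_A` of all values in `F_A` of the words in `I`. -/
def verbalSubgroupOf (I : Set (FreeGroup ℕ)) (A : Type u) : Subgroup (FreeGroup A) :=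
  Subgroup.normalClosure {g | ∃ w ∈ I, ∃ φ : FreeGroup ℕ →* FreeGroup A, φ w = g}

namespace GroupVariety

/-- `V` is the variety of all groups. -/
def IsAllGroups (V : GroupVariety.{u}) : Prop :=
  ∀ (G : Type u) [Group G], V.Mem G

/-- The finite trace of `V`: the pseudovariety of all finite groups in `V`. -/
def finiteTrace (V : GroupVariety.{u}) : GroupPseudovariety.{u} where
  Mem G _ := V.Mem G ∧ Finite G
  finite_of_mem _ _ h := h.2
  subgroup_mem G _ h H := ⟨V.subgroup_mem G h.1 H, GroupPseudovariety.allFinite.subgroup_mem G h.2 H⟩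
  image_mem G K _ _ f hf h := ⟨V.image_mem G K f hf h.1, haveI := h.2; Finite.of_surjective f hf⟩
  pi_mem ι _ G _ h :=
    ⟨V.pi_mem ι G fun i => (h i).1, GroupPseudovariety.allFinite.pi_mem ι G fun i => (h i).2⟩

/-- The identities satisfied by all groups in `V`. -/
def identities (V : GroupVariety.{u}) : Set (FreeGroup ℕ) :=
  {w | ∀ (G : Type u) [Group G], V.Mem G → SatisfiesIdentity G w}

/-- `V` is the class of all groups satisfying the identities in `I`. -/
def IsDefinedBy (V : GroupVariety.{u}) (I : Set (FreeGroup ℕ)) : Prop :=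
  ∀ (G : Type u) [Group G], V.Mem G ↔ ∀ w ∈ I, SatisfiesIdentity G w

/-- The verbal subgroup `F_A^V`: the normal closure of all values in `F_A` of the identities of `V`.
By `verbalSubgroupOf_eq` below, any set of identities defining `V` gives the same subgroup. -/
def verbalSubgroup (V : GroupVariety.{u}) (A : Type u) : Subgroup (FreeGroup A) :=
  verbalSubgroupOf V.identities A

instance (V : GroupVariety.{u}) (A : Type u) : (V.verbalSubgroup A).Normal :=
  Subgroup.normalClosure_normal

theorem verbalSubgroupOf_eq (V : GroupVariety.{u}) (A : Type u) (I : Set (FreeGroup ℕ))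
    (hI : V.IsDefinedBy I) : verbalSubgroupOf I A = V.verbalSubgroup A := by
  apply le_antisymm
  · refine Subgroup.normalClosure_mono ?_
    rintro g ⟨w, hw, φ, rfl⟩
    exact ⟨w, fun G _ hG => (hI G).1 hG w hw, φ, rfl⟩
  · have : (verbalSubgroupOf I A).Normal := Subgroup.normalClosure_normal
    refine Subgroup.normalClosure_le_normal ?_
    rintro g ⟨w, hw, φ, rfl⟩
    have hmem : V.Mem (FreeGroup A ⧸ verbalSubgroupOf I A) := by
      rw [hI]
      intro v hv ψ
      choose s hs using fun n : ℕ => QuotientGroup.mk_surjective (ψ (FreeGroup.of n))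
      have hψ : ψ = (QuotientGroup.mk' (verbalSubgroupOf I A)).comp (FreeGroup.lift s) := by
        ext n
        simp [hs]
      rw [hψ, MonoidHom.comp_apply, QuotientGroup.mk'_apply, QuotientGroup.eq_one_iff]
      exact Subgroup.subset_normalClosure ⟨v, hv, FreeGroup.lift s, rfl⟩
    have h := hw _ hmem ((QuotientGroup.mk' (verbalSubgroupOf I A)).comp φ)
    rwa [MonoidHom.comp_apply, QuotientGroup.mk'_apply, QuotientGroup.eq_one_iff] at h

/-- The canonical homomorphism from `F_A` onto the relatively free group `F_A / F_A^V`. -/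
def proj (V : GroupVariety.{u}) (A : Type u) : FreeGroup A →* FreeGroup A ⧸ V.verbalSubgroup A :=
  QuotientGroup.mk' (V.verbalSubgroup A)

end GroupVariety

/-- The subgroup of `F_A` generated by finitely many group words `L` over the letters in `B`, where
the letter `b` stands for the generator `ν b` of `F_A`; the pair `(b, true)` is the letter `b` and
`(b, false)` is its inverse. -/
def subgroupOfWords {A B : Type*} (ν : B → A) (L : List (List (B × Bool))) :
    Subgroup (FreeGroup A) :=
  Subgroup.closure {g | ∃ w ∈ L, g = FreeGroup.mk (w.map fun x => (ν x.1, x.2))}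

/-! Homomorphisms from `F_A` to groups of `V` kill `F_A^V`, and every finite image of `F_A/F_A^V`
lies in `V`. So the pro-`V^f` topology is the profinite topology pulled back along `proj`, and every
closure contains `F_A^V`.

Two facts about free groups, both proved with Schreier graphs, carry the rest. M. Hall's theorem
(`exists_finiteIndex_notMem`) makes finitely generated subgroups closed when `V` is everything, or
when `F_A^V = 1`. A finitely generated subgroup containing a nontrivial normal subgroup has finite
index (`finiteIndex_of_normal_le`); this applies to a finitely generated closure as soon as `F_A^V ≠
1`. If `A` is infinite, no finitely generated subgroup contains `F_A^V ≠ 1`. If `|A| ≥ 2` and `F_A^V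
= 1`, then `V` contains the 2-generated symmetric groups, hence all finite groups, hence, by
residual finiteness, all groups.

For decidability with `F_A^V ≠ 1`: `H` is closed iff it contains the kernel of a homomorphism to a
group of `V^f`, and it is not closed iff some `P ≥ H` of finite index has `F_A/core(P)` outside `V`.
Both are witnessed by finite data that can be checked with the help of the membership algorithm for
`V^f`, so an unbounded search for either kind of witness terminates. If `F_A^V = 1`, every finitely
generated `H` is closed. -/

namespace FreeGroup

/-! ### Schreier graphs and M. Hall's theorem -/

variable {A : Type*}

/-- Two actions of a free group that agree along the edges inside `X` agree along paths in `X`. -/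
theorem perm_mk_apply_of_tails_mem {Ω Λ : Type*} [MulAction (FreeGroup A) Λ] (ι : Λ → Ω)
    (X : Set Λ) (ρ : FreeGroup A →* Equiv.Perm Ω)
    (h : ∀ a, ∀ x ∈ X, of a • x ∈ X → ρ (of a) (ι x) = ι (of a • x)) (o : Λ)
    (l : List (A × Bool)) (hl : ∀ t, t <:+ l → mk t • o ∈ X) :
    ρ (mk l) (ι o) = ι (mk l • o) := by
  induction l with
  | nil => simp [← one_eq_mk]
  | cons p l ih =>
    have hX : mk l • o ∈ X := hl l (List.suffix_cons p l)
    have hX' : mk (p :: l) • o ∈ X := hl _ (List.suffix_refl _)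
    have ih := ih fun t ht => hl t (ht.trans (List.suffix_cons p l))
    have hmul : mk (p :: l) = mk [p] * mk l := by simp [mul_mk]
    rw [hmul, mul_smul] at hX' ⊢
    rw [_root_.map_mul, Equiv.Perm.mul_apply, ih]
    obtain ⟨a, _ | _⟩ := p
    · have hinv : (mk [(a, false)] : FreeGroup A) = (of a)⁻¹ := by simp [of, inv_mk, invRev]
      rw [hinv] at hX' ⊢
      -- An inverse letter runs through an edge backwards, so `h` is applied at the end point of the
      -- step.
      have := h a _ hX' (by simpa using hX)
      rw [smul_inv_smul] at this
      rw [_root_.map_inv, Equiv.Perm.inv_eq_iff_eq, this]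
    · exact h a _ hX hX'

section

variable [DecidableEq A]

/-- The vertices of a Schreier graph that are visited when the words in `S` are read. -/
def visited {Λ : Type*} [MulAction (FreeGroup A) Λ] (o : Λ) (S : Set (FreeGroup A)) : Set Λ :=
  {x | ∃ s ∈ S, ∃ t, t <:+ s.toWord ∧ mk t • o = x}

theorem finite_visited {Λ : Type*} [MulAction (FreeGroup A) Λ] (o : Λ) {S : Set (FreeGroup A)}
    (hS : S.Finite) : (visited o S).Finite := by
  have : visited o S = ⋃ s ∈ S, (fun t => mk t • o) '' {t | t <:+ s.toWord} := by
    ext x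
    simp [visited]
  rw [this]
  refine hS.biUnion fun s _ => Set.Finite.image _ ?_
  have : {t | t <:+ s.toWord} = {t | t ∈ s.toWord.tails} := by
    ext t
    simp
  rw [this]
  exact List.finite_toSet _

theorem mk_smul_mem_visited {Λ : Type*} [MulAction (FreeGroup A) Λ] {o : Λ}
    {S : Set (FreeGroup A)} {s : FreeGroup A} (hs : s ∈ S) {t : List (A × Bool)}
    (ht : t <:+ s.toWord) : mk t • o ∈ visited o S :=
  ⟨s, hs, t, ht, rfl⟩

theorem perm_apply_of_mem {Ω Λ : Type*} [MulAction (FreeGroup A) Λ] (ι : Λ → Ω)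
    (o : Λ) (S : Set (FreeGroup A)) (ρ : FreeGroup A →* Equiv.Perm Ω)
    (h : ∀ a, ∀ x ∈ visited o S, of a • x ∈ visited o S → ρ (of a) (ι x) = ι (of a • x))
    {s : FreeGroup A} (hs : s ∈ S) : ρ s (ι o) = ι (s • o) := by
  have := perm_mk_apply_of_tails_mem ι _ ρ h o s.toWord fun t ht => mk_smul_mem_visited hs ht
  rwa [mk_toWord] at this

end

/-- A partial action of the letters on a finite set `X` of vertices extends to an action. -/
theorem exists_perm_extending {Λ : Type*} [MulAction (FreeGroup A) Λ] {X : Set Λ}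
    (hX : X.Finite) :
    ∃ ρ : FreeGroup A →* Equiv.Perm X,
      ∀ a (x : Λ) (hx : x ∈ X) (hax : of a • x ∈ X), ρ (of a) ⟨x, hx⟩ = ⟨of a • x, hax⟩ := by
  classical
  have := hX.to_subtype
  let p (a : A) (x : X) : Prop := of a • (x : Λ) ∈ X
  let q (a : A) (x : X) : Prop := (of a)⁻¹ • (x : Λ) ∈ X
  -- Each letter is a partial injection of `X`; finiteness of `X` lets it be completed to a
  -- permutation.
  let e (a : A) : {x : X // p a x} ≃ {x : X // q a x} :=
    { toFun x := ⟨⟨of a • (x : Λ), x.2⟩, by simp [p, q]⟩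
      invFun x := ⟨⟨(of a)⁻¹ • (x : Λ), x.2⟩, by simp [p, q]⟩
      left_inv x := by simp
      right_inv x := by simp }
  refine ⟨lift fun a => Equiv.extendSubtype (α := X) (p := p a) (q := q a) (e a), fun a x hx hax => ?_⟩
  rw [lift_apply_of, Equiv.extendSubtype_apply_of_mem (p := p a) (q := q a) _ _ hax]
  rfl

/-- **M. Hall's theorem**: finitely generated subgroups of free groups are separable. -/
theorem exists_finiteIndex_notMem {C : Subgroup (FreeGroup A)} (hC : C.FG) {x : FreeGroup A}
    (hx : x ∉ C) : ∃ P : Subgroup (FreeGroup A), P.FiniteIndex ∧ C ≤ P ∧ x ∉ P := by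
  classical
  obtain ⟨S, rfl⟩ := hC
  let o : FreeGroup A ⧸ Subgroup.closure (S : Set (FreeGroup A)) :=
    QuotientGroup.mk (1 : FreeGroup A)
  -- Reading `x` as well keeps the end point of its path in the finite graph, where it stays
  -- different from `o`.
  let T : Set (FreeGroup A) := insert x S
  have hfin : (visited o T).Finite := finite_visited o (S.finite_toSet.insert x)
  obtain ⟨ρ, hρ⟩ := exists_perm_extending (A := A) hfin
  have ho : o ∈ visited o T :=
    ⟨x, Set.mem_insert _ _, [], List.nil_suffix, by rw [← one_eq_mk, one_smul]⟩
  let ι : FreeGroup A ⧸ Subgroup.closure (S : Set (FreeGroup A)) → visited o T :=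
    fun y => if hy : y ∈ visited o T then ⟨y, hy⟩ else ⟨o, ho⟩
  have hι : ∀ y (hy : y ∈ visited o T), ι y = ⟨y, hy⟩ := fun y hy => dif_pos hy
  have key : ∀ s : FreeGroup A, s ∈ T → ρ s (ι o) = ι (s • o) := fun s hs =>
    perm_apply_of_mem ι o T ρ (fun a y hy hay => by rw [hι y hy, hι _ hay, hρ]) hs
  have := hfin.to_subtype
  have hmk : ∀ g : FreeGroup A, g • o = (g : FreeGroup A ⧸ Subgroup.closure (S : Set (FreeGroup A))) :=
    fun g => by simp [o]
  -- `P` is the stabilizer of the base point in a finite permutation representation.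
  refine ⟨(MulAction.stabilizer (Equiv.Perm (visited o T)) (ι o)).comap ρ, ?_, ?_, ?_⟩
  · refine Subgroup.finiteIndex_of_le (H := ρ.ker) fun g hg => ?_
    rw [Subgroup.mem_comap, MonoidHom.mem_ker.1 hg]
    exact one_mem _
  · rw [Subgroup.closure_le]
    intro s hs
    have : s • o = o := by
      rw [hmk]
      exact (QuotientGroup.eq.2 (by simpa using Subgroup.subset_closure hs)).symm
    have h2 := key s (Set.mem_insert_of_mem _ hs)
    rw [this] at h2
    exact h2
  · intro h
    have h1 : ρ x (ι o) = ι o := h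
    have hxo : x • o ∈ visited o T :=
      ⟨x, Set.mem_insert _ _, _, List.suffix_refl _, by rw [mk_toWord]⟩
    rw [key x (Set.mem_insert _ _), hι _ ho, hι _ hxo, Subtype.mk.injEq, hmk] at h1
    exact hx (by simpa using QuotientGroup.eq.1 h1.symm)

/-! ### Finitely generated subgroups containing a normal subgroup -/

section

variable {Λ : Type*} [MulAction (FreeGroup A) Λ] [DecidableEq (Λ ⊕ FreeGroup A)]

/-- The disjoint union of a Schreier graph and the Cayley graph of the free group, with the two
edges labelled `a` that end in `z` and in `a` exchanging their end points. -/
noncomputable def switchedPerm (a : A) (z : Λ) : FreeGroup A →* Equiv.Perm (Λ ⊕ FreeGroup A) :=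
  letI := Classical.decEq A
  lift fun b =>
    (if b = a then Equiv.swap (Sum.inl z) (Sum.inr (of a)) else 1) *
      Equiv.sumCongr (MulAction.toPerm (of b)) (Equiv.mulLeft (of b))

theorem switchedPerm_of_inl {a : A} {z : Λ} (b : A) {y : Λ} (hy : of b • y ≠ z) :
    switchedPerm a z (of b) (Sum.inl y) = Sum.inl (of b • y) := by
  rw [switchedPerm, lift_apply_of]
  split_ifs with h
  · simp [Equiv.swap_apply_of_ne_of_ne, hy]
  · simp

theorem switchedPerm_of_inl_self {a : A} {z y : Λ} (hy : of a • y = z) :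
    switchedPerm a z (of a) (Sum.inl y) = Sum.inr (of a) := by
  rw [switchedPerm, lift_apply_of, if_pos rfl]
  simp [hy]

theorem switchedPerm_of_inr {a : A} {z : Λ} (b : A) {q : FreeGroup A} (hq : q ≠ 1) :
    switchedPerm a z (of b) (Sum.inr q) = Sum.inr (of b * q) := by
  rw [switchedPerm, lift_apply_of]
  split_ifs with h
  · subst h
    simp [Equiv.swap_apply_of_ne_of_ne, hq]
  · simp

/-- The only altered edge of the Cayley graph starts at `1`, and a path from `q` shorter than the
norm of `q` never reaches `1`. -/
theorem switchedPerm_mk_inr [DecidableEq A] {a : A} {z : Λ} (l : List (A × Bool))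
    (q : FreeGroup A) (hq : l.length < q.norm) :
    switchedPerm a z (mk l) (Sum.inr q) = Sum.inr (mk l * q) := by
  induction l with
  | nil => simp [← one_eq_mk]
  | cons p l ih =>
    have hne : ∀ t : List (A × Bool), t.length < q.norm → mk t * q ≠ 1 := by
      intro t ht h
      have := norm_mk_le (L₁ := t)
      rw [mul_eq_one_iff_eq_inv.1 h, norm_inv_eq] at this
      omega
    rw [List.length_cons] at hq
    have hmul : mk (p :: l) = mk [p] * mk l := by simp [mul_mk]
    rw [hmul, _root_.map_mul, Equiv.Perm.mul_apply, ih (by omega), mul_assoc]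
    obtain ⟨b, _ | _⟩ := p
    · have hinv : (mk [(b, false)] : FreeGroup A) = (of b)⁻¹ := by simp [of, inv_mk, invRev]
      have h1 : (of b)⁻¹ * (mk l * q) ≠ 1 := by
        rw [← hinv, ← mul_assoc, ← hmul]
        exact hne _ (by simpa using hq)
      rw [hinv, _root_.map_inv, Equiv.Perm.inv_eq_iff_eq, switchedPerm_of_inr b h1, mul_inv_cancel_left]
    · exact switchedPerm_of_inr b (hne l (by omega))

end

/-- A finitely generated subgroup of a free group that contains a nontrivial normal subgroup has
finite index. -/
theorem finiteIndex_of_normal_le {C M : Subgroup (FreeGroup A)} (hC : C.FG) [M.Normal]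
    (hM : M ≠ ⊥) (hMC : M ≤ C) : C.FiniteIndex := by
  classical
  by_contra hfi
  obtain ⟨w, hwM, hw⟩ := M.bot_or_exists_ne_one.resolve_left hM
  obtain ⟨S, rfl⟩ := hC
  set C := Subgroup.closure (S : Set (FreeGroup A)) with hCdef
  let o : FreeGroup A ⧸ C := QuotientGroup.mk (1 : FreeGroup A)
  have hmk : ∀ g : FreeGroup A, g • o = (g : FreeGroup A ⧸ C) :=
    fun g => by simp [o]
  let T : Set (FreeGroup A) := insert 1 S
  set X := visited o T with hX
  have hfin : X.Finite := finite_visited o (S.finite_toSet.insert 1)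
  have ho : o ∈ X := ⟨1, Set.mem_insert _ _, [], List.nil_suffix, by simp [← one_eq_mk]⟩
  -- If no edge left the finite set `X`, then `X` would be invariant, hence the whole coset space,
  -- and the index would be finite.
  obtain ⟨a, x, hx, hax⟩ : ∃ a, ∃ x ∈ X, of a • x ∉ X := by
    by_contra hcl
    push Not at hcl
    have hstab : ∀ g : FreeGroup A, ∀ x ∈ X, g • x ∈ X := by
      intro g
      induction g using FreeGroup.induction_on with
      | C1 => simp
      | of b => exact hcl b
      | inv_of b _ =>
        have hbij : Set.SurjOn (fun x => of b • x) X X := by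
          have h := Finset.surjOn_of_injOn_of_card_le (s := hfin.toFinset) (t := hfin.toFinset)
            (fun x => of b • x) (by simpa [Set.MapsTo] using hcl b)
            (MulAction.injective (of b)).injOn le_rfl
          simpa using h
        intro x hx
        obtain ⟨y, hy, rfl⟩ := hbij hx
        simpa using hy
      | mul g h hg hh =>
        intro x hx
        rw [mul_smul]
        exact hg _ (hh x hx)
    have huniv : X = Set.univ := by
      ext y
      obtain ⟨g, rfl⟩ := QuotientGroup.mk_surjective y
      simpa [hmk] using hstab g o ho
    rw [huniv, Set.finite_univ_iff] at hfin
    exact hfi Subgroup.finiteIndex_of_finite_quotient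
  -- The edge leaving `X` is redirected into the Cayley graph. Paths inside `X` are unaffected, so
  -- `C` still fixes `o`; by normality `M` then fixes the whole orbit of `o`. But this orbit now
  -- contains arbitrarily large powers of `a` in the Cayley graph, where `w` acts by translation.
  set ρ := switchedPerm a (of a • x) with hρdef
  have hρ : ∀ b, ∀ y ∈ X, of b • y ∈ X → ρ (of b) (Sum.inl y) = Sum.inl (of b • y) :=
    fun b y _ hby => switchedPerm_of_inl b fun h => hax (h ▸ hby)
  have hCfix : ∀ g ∈ C, ρ g (Sum.inl o) = Sum.inl o := by
    have : C ≤ (MulAction.stabilizer (Equiv.Perm _) (Sum.inl o : (FreeGroup A ⧸ C) ⊕ FreeGroup A)).comap ρ := by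
      refine (Subgroup.closure_le _).2 fun s hs => ?_
      have h1 := perm_apply_of_mem Sum.inl o T ρ hρ (Set.mem_insert_of_mem _ hs)
      have h2 : s • o = o := by
        rw [hmk]
        exact (QuotientGroup.eq.2 (by simpa using Subgroup.subset_closure hs)).symm
      rwa [h2] at h1
    exact fun g hg => this hg
  have hMfix : ∀ g, ∀ m ∈ M, ρ m (ρ g (Sum.inl o)) = ρ g (Sum.inl o) := by
    intro g m hm
    have h1 : g⁻¹ * m * g ∈ M := by
      simpa using ‹M.Normal›.conj_mem m hm g⁻¹
    have h2 := congrArg (ρ g) (hCfix _ (hMC h1))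
    rwa [← Equiv.Perm.mul_apply, ← _root_.map_mul, ← mul_assoc, ← mul_assoc, mul_inv_cancel, one_mul,
      _root_.map_mul, Equiv.Perm.mul_apply] at h2
  obtain ⟨s, hs, t, ht, rfl⟩ := hx
  have hxo : ρ (mk t) (Sum.inl o) = Sum.inl (mk t • o) :=
    perm_mk_apply_of_tails_mem Sum.inl X ρ hρ o t fun t' ht' =>
      mk_smul_mem_visited hs (ht'.trans ht)
  have hpow : ∀ k : ℕ, ρ (of a ^ (k + 1) * mk t) (Sum.inl o) = Sum.inr (of a ^ (k + 1)) := by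
    intro k
    induction k with
    | zero =>
      rw [zero_add, pow_one, _root_.map_mul, Equiv.Perm.mul_apply, hxo]
      exact switchedPerm_of_inl_self rfl
    | succ k ih =>
      rw [pow_succ' _ (k + 1), mul_assoc, _root_.map_mul, Equiv.Perm.mul_apply, ih]
      refine switchedPerm_of_inr a fun h => ?_
      have := norm_of_pow a (k + 1)
      rw [h, norm_one] at this
      omega
  -- The exponent exceeds the length of `w`, so reading `w` cannot lead back to `1`.
  have h1 := hMfix (of a ^ (w.toWord.length + 1) * mk t) w hwM
  rw [hpow w.toWord.length] at h1
  have h2 := switchedPerm_mk_inr (a := a) (z := of a • mk t • o) w.toWord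
    (of a ^ (w.toWord.length + 1)) (by rw [norm_of_pow]; omega)
  rw [mk_toWord, ← hρdef, h1, Sum.inr.injEq] at h2
  exact hw (by simpa using h2)

end FreeGroup

namespace FreeGroup

/-- Homomorphisms that agree on the letters of a word agree on the word. -/
theorem hom_mk_congr {A G : Type*} [Group G] (f g : FreeGroup A →* G) (l : List (A × Bool))
    (h : ∀ p ∈ l, f (of p.1) = g (of p.1)) : f (mk l) = g (mk l) := by
  have key : ∀ k : FreeGroup A →* G, k = lift fun a => k (of a) := fun k => by ext; simp
  rw [key f, key g, lift_mk, lift_mk]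
  congr 1
  refine List.map_congr_left fun p hp => ?_
  simp only [h p hp]

/-- An element of a free group involves finitely many letters, so it lies in the image of a free
group of countable rank. -/
theorem exists_hom_hom_apply_eq {A : Type*} (x : FreeGroup A) :
    ∃ (ρ : FreeGroup A →* FreeGroup ℕ) (φ : FreeGroup ℕ →* FreeGroup A), φ (ρ x) = x := by
  classical
  let B : Set A := {a | ∃ p ∈ x.toWord, p.1 = a}
  have hB : B.Finite := by
    have : B = Prod.fst '' {p | p ∈ x.toWord} := by ext; simp [B]
    rw [this]
    exact (List.finite_toSet _).image _
  obtain ⟨j, hj⟩ := Set.countable_iff_exists_injOn.1 hB.countable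
  refine ⟨lift fun a => of (j a), lift fun k =>
    if h : ∃ a ∈ B, j a = k then of h.choose else 1, ?_⟩
  have := hom_mk_congr ((lift fun k => if h : ∃ a ∈ B, j a = k then of h.choose else 1).comp
    (lift fun a => of (j a))) (MonoidHom.id (FreeGroup A)) x.toWord fun p hp => ?_
  · rwa [mk_toWord] at this
  · have hp' : p.1 ∈ B := ⟨p, hp, rfl⟩
    have hex : ∃ a ∈ B, j a = j p.1 := ⟨p.1, hp', rfl⟩
    have hch : hex.choose = p.1 := hj hex.choose_spec.1 hp' hex.choose_spec.2
    simp only [MonoidHom.comp_apply, lift_apply_of, MonoidHom.id_apply]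
    rw [dif_pos hex, hch]

end FreeGroup

/-! ### Verbal subgroups and relatively free groups -/

namespace GroupVariety

variable (V : GroupVariety.{u})

theorem mem_of_injective {G K : Type u} [Group G] [Group K] (f : G →* K)
    (hf : Function.Injective f) (hK : V.Mem K) : V.Mem G :=
  V.image_mem _ _ (MonoidHom.ofInjective hf).symm.toMonoidHom
    (MonoidHom.ofInjective hf).symm.surjective (V.subgroup_mem K hK f.range)

theorem verbalSubgroup_le_ker {A G : Type u} [Group G] (hG : V.Mem G) (f : FreeGroup A →* G) :
    V.verbalSubgroup A ≤ f.ker := by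
  refine Subgroup.normalClosure_le_normal ?_
  rintro g ⟨w, hw, φ, rfl⟩
  exact hw G hG (f.comp φ)

/-- Renaming the finitely many letters of `x` turns it into an identity of `V`, and `x` is a value
of that identity. -/
theorem mem_verbalSubgroup_of_forall {A : Type u} {x : FreeGroup A}
    (h : ∀ (G : Type u) [Group G], V.Mem G → ∀ f : FreeGroup A →* G, f x = 1) :
    x ∈ V.verbalSubgroup A := by
  obtain ⟨ρ, φ, hx⟩ := FreeGroup.exists_hom_hom_apply_eq x
  exact Subgroup.subset_normalClosure
    ⟨ρ x, fun G _ hG ψ => h G hG (ψ.comp ρ), φ, hx⟩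

/-- The relatively free groups of a variety belong to it. -/
theorem mem_quotient_verbalSubgroup (A : Type u) :
    V.Mem (FreeGroup A ⧸ V.verbalSubgroup A) := by
  -- The groups of `V` form a proper class; the quotients of `F_A` in `V` form a small family that
  -- detects the same elements.
  let Ω : Type u := {M : Subgroup (FreeGroup A) // ∃ _ : M.Normal, V.Mem (FreeGroup A ⧸ M)}
  have hn : ∀ M : Ω, M.1.Normal := fun M => M.2.choose
  let f : FreeGroup A →* ∀ M : Ω, FreeGroup A ⧸ M.1 :=
    MonoidHom.pi fun M => QuotientGroup.mk' M.1
  have hle : V.verbalSubgroup A ≤ f.ker :=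
    V.verbalSubgroup_le_ker (V.pi_mem _ _ fun M => M.2.choose_spec) f
  refine V.mem_of_injective (QuotientGroup.lift _ f hle) ?_
    (V.pi_mem _ _ fun M => M.2.choose_spec)
  rw [injective_iff_map_eq_one]
  intro y hy
  obtain ⟨x, rfl⟩ := QuotientGroup.mk_surjective y
  rw [QuotientGroup.eq_one_iff]
  refine V.mem_verbalSubgroup_of_forall fun G _ hG g => ?_
  have hmem : V.Mem (FreeGroup A ⧸ g.ker) :=
    V.mem_of_injective (QuotientGroup.kerLift g) (QuotientGroup.kerLift_injective g) hG
  have := congrFun hy ⟨g.ker, inferInstance, hmem⟩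
  exact (QuotientGroup.eq_one_iff x).1 this

theorem map_mem_verbalSubgroup {A B : Type u} (f : FreeGroup A →* FreeGroup B) {x : FreeGroup A}
    (hx : x ∈ V.verbalSubgroup A) : f x ∈ V.verbalSubgroup B :=
  V.mem_verbalSubgroup_of_forall fun _ _ hG g => V.verbalSubgroup_le_ker hG (g.comp f) hx

theorem verbalSubgroup_ne_bot_of_injective {A B : Type u} (j : A → B)
    (hj : Function.Injective j) (hA : V.verbalSubgroup A ≠ ⊥) : V.verbalSubgroup B ≠ ⊥ := by
  obtain ⟨x, hx, hx1⟩ := (V.verbalSubgroup A).bot_or_exists_ne_one.resolve_left hA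
  intro hB
  have := V.map_mem_verbalSubgroup (FreeGroup.map j) hx
  rw [hB, Subgroup.mem_bot] at this
  exact hx1 (FreeGroup.map_injective hj (by simpa using this))

/-- A variety in which some free group of rank at least two is relatively free contains all finite
groups. -/
theorem mem_of_finite_of_verbalSubgroup_eq_bot {A : Type u} [Nontrivial A]
    (hA : V.verbalSubgroup A = ⊥) (G : Type u) [Group G] [Finite G] : V.Mem G := by
  classical
  obtain ⟨a, b, hab⟩ := exists_pair_ne A
  obtain ⟨n, ⟨e⟩⟩ := Finite.exists_equiv_fin G
  have hF : V.Mem (FreeGroup A) :=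
    V.mem_of_injective (QuotientGroup.mk' (V.verbalSubgroup A))
      (by rw [← MonoidHom.ker_eq_bot_iff, QuotientGroup.ker_mk', hA])
      (V.mem_quotient_verbalSubgroup A)
  -- A long cycle and an adjacent transposition generate the symmetric group; `n + 2` points make
  -- both available for every `n`, and Cayley's theorem embeds `G`.
  let c : Equiv.Perm (Fin (n + 2)) := finRotate (n + 2)
  let s : Equiv.Perm (Fin (n + 2)) := Equiv.swap 0 (c 0)
  let f : FreeGroup A →* Equiv.Perm (Fin (n + 2)) :=
    FreeGroup.lift fun x => if x = a then c else s
  have hf : f.range = ⊤ := by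
    rw [eq_top_iff, ← Equiv.Perm.closure_cycle_adjacent_swap isCycle_finRotate
      support_finRotate 0, Subgroup.closure_le]
    rintro _ (rfl | rfl)
    · exact ⟨FreeGroup.of a, by simp [f, c]⟩
    · exact ⟨FreeGroup.of b, by simp [f, hab.symm, s, c]⟩
  have hP : V.Mem (ULift.{u} (Equiv.Perm (Fin (n + 2)))) :=
    V.image_mem _ _ (MulEquiv.ulift.symm.toMonoidHom.comp f)
      (MulEquiv.ulift.symm.surjective.comp (MonoidHom.range_eq_top.1 hf)) hF
  let i : G ↪ Fin (n + 2) := e.toEmbedding.trans (Fin.castAddEmb 2)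
  refine V.mem_of_injective (MulEquiv.ulift.symm.toMonoidHom.comp
    ((Equiv.Perm.viaEmbeddingHom i).comp (MulAction.toPermHom G G))) ?_ hP
  exact MulEquiv.ulift.symm.injective.comp
    ((Equiv.Perm.viaEmbeddingHom_injective i).comp MulAction.toPerm_injective)

/-- All finite groups lie in `V`, so a nontrivial element of any `F_B^V` would survive in some
finite quotient of `F_B`, which is impossible. Hence all free groups, and all their quotients, lie
in `V`. -/
theorem isAllGroups_of_verbalSubgroup_eq_bot {A : Type u} [Nontrivial A]
    (hA : V.verbalSubgroup A = ⊥) : V.IsAllGroups := by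
  have key : ∀ B : Type u, V.verbalSubgroup B = ⊥ := by
    intro B
    rw [eq_bot_iff]
    intro x hx
    by_contra hx1
    obtain ⟨P, hP, -, hxP⟩ := FreeGroup.exists_finiteIndex_notMem ⟨∅, by simp⟩ hx1
    have := V.verbalSubgroup_le_ker
      (V.mem_of_finite_of_verbalSubgroup_eq_bot hA (FreeGroup B ⧸ P.normalCore))
      (QuotientGroup.mk' _) hx
    rw [QuotientGroup.ker_mk'] at this
    exact hxP (P.normalCore_le this)
  intro G _
  let f : FreeGroup G ⧸ V.verbalSubgroup G →* G :=
    QuotientGroup.lift _ (FreeGroup.lift id) (by rw [key]; exact bot_le)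
  refine V.image_mem _ _ f (fun g => ⟨QuotientGroup.mk (FreeGroup.of g), ?_⟩)
    (V.mem_quotient_verbalSubgroup G)
  simp [f]

end GroupVariety

/-! ### Closures in pro-`W` topologies -/

namespace GroupPseudovariety

variable (W : GroupPseudovariety.{u}) {G : Type u} [Group G]

theorem topology_le_induced {K : Type u} [Group K] (hK : W.Mem K) (f : G →* K) :
    W.topology G ≤ TopologicalSpace.induced f ⊥ :=
  iInf_le_of_le K <| iInf_le_of_le _ <| iInf_le_of_le hK <| iInf_le _ f

theorem isOpen_preimage {K : Type u} [Group K] (hK : W.Mem K) (f : G →* K) (s : Set K) :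
    @IsOpen G (W.topology G) (f ⁻¹' s) :=
  W.topology_le_induced hK f _ ⟨s, @isOpen_discrete _ ⊥ (@DiscreteTopology.mk _ ⊥ rfl) s, rfl⟩

theorem le_closure (H : Subgroup G) : H ≤ W.closure H :=
  let _ := W.topology G
  have := W.isTopologicalGroup G
  H.le_topologicalClosure

theorem coe_closure (H : Subgroup G) :
    (W.closure H : Set G) = @_root_.closure G (W.topology G) H :=
  rfl

theorem isClosedSubgroup_iff (H : Subgroup G) : W.IsClosedSubgroup H ↔ W.closure H = H := by
  rw [← SetLike.coe_set_eq, coe_closure, IsClosedSubgroup]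
  let _ := W.topology G
  exact closure_eq_iff_isClosed.symm

/-- The fibre of `f` through `x` is an open neighbourhood of `x`, so it meets `H`. -/
theorem map_mem_of_mem_closure {H : Subgroup G} {x : G} (hx : x ∈ W.closure H) {K : Type u}
    [Group K] (hK : W.Mem K) (f : G →* K) : f x ∈ H.map f := by
  let _ := W.topology G
  have hx' : x ∈ _root_.closure (H : Set G) := hx
  obtain ⟨y, hy, hyH⟩ := mem_closure_iff.1 hx' _ (W.isOpen_preimage hK f {f x}) rfl
  exact ⟨y, hyH, hy⟩

theorem isClosedSubgroup_of_ker_le {H : Subgroup G} {K : Type u} [Group K] (hK : W.Mem K)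
    (f : G →* K) (hf : f.ker ≤ H) : W.IsClosedSubgroup H := by
  have h : (H : Set G) = f ⁻¹' (H.map f) := by
    rw [← Subgroup.coe_comap, Subgroup.comap_map_eq_self hf]
  let _ := W.topology G
  rw [IsClosedSubgroup, h, ← isOpen_compl_iff, ← Set.preimage_compl]
  exact W.isOpen_preimage hK f _

theorem closure_eq_of_exists {H : Subgroup G}
    (h : ∀ x ∉ H, ∃ P : Subgroup G, H ≤ P ∧ x ∉ P ∧ W.Mem (G ⧸ P.normalCore)) :
    W.closure H = H := by
  refine le_antisymm (fun x hx => ?_) (W.le_closure H)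
  by_contra hxH
  obtain ⟨P, hHP, hxP, hP⟩ := h x hxH
  obtain ⟨y, hy, hyx⟩ := W.map_mem_of_mem_closure hx hP (QuotientGroup.mk' _)
  have h1 : y⁻¹ * x ∈ P.normalCore := QuotientGroup.eq.1 hyx
  exact hxP (by simpa using P.mul_mem (hHP hy) (P.normalCore_le h1))

end GroupPseudovariety

/-! ### The pro-`V^f` closure and its finite generation -/

namespace GroupVariety

variable (V : GroupVariety.{u})

theorem topology_finiteTrace_eq_induced (A : Type u) :
    V.finiteTrace.topology (FreeGroup A) =
      TopologicalSpace.induced (V.proj A)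
        (GroupPseudovariety.allFinite.topology (FreeGroup A ⧸ V.verbalSubgroup A)) := by
  simp only [GroupPseudovariety.topology, induced_iInf, induced_compose]
  apply le_antisymm
  · refine le_iInf fun K => le_iInf fun _ => le_iInf fun hK => le_iInf fun f => ?_
    have : Finite K := hK
    -- The finite group `K` need not lie in `V`, but the image of the relatively free group does.
    have hmem : V.finiteTrace.Mem f.range := by
      refine ⟨V.image_mem _ _ f.rangeRestrict f.rangeRestrict_surjective
        (V.mem_quotient_verbalSubgroup A), inferInstance⟩
    refine (V.finiteTrace.topology_le_induced hmem (f.rangeRestrict.comp (V.proj A))).trans ?_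
    have : (f ∘ V.proj A : FreeGroup A → K) =
        Subtype.val ∘ (f.rangeRestrict.comp (V.proj A)) := rfl
    rw [this, ← induced_compose]
    exact induced_mono bot_le
  · refine le_iInf fun K => le_iInf fun _ => le_iInf fun hK => le_iInf fun f => ?_
    let g : FreeGroup A ⧸ V.verbalSubgroup A →* K :=
      QuotientGroup.lift _ f (V.verbalSubgroup_le_ker hK.1 f)
    have hg : (f : FreeGroup A → K) = g ∘ V.proj A := rfl
    rw [hg]
    exact iInf_le_of_le K <| iInf_le_of_le _ <| iInf_le_of_le hK.2 <| iInf_le _ g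

theorem closure_finiteTrace_eq_comap {A : Type u} (H : Subgroup (FreeGroup A)) :
    V.finiteTrace.closure H =
      (GroupPseudovariety.allFinite.closure (H.map (V.proj A))).comap (V.proj A) := by
  rw [← SetLike.coe_set_eq, Subgroup.coe_comap, GroupPseudovariety.coe_closure,
    GroupPseudovariety.coe_closure, V.topology_finiteTrace_eq_induced]
  ext x
  exact @closure_induced _ _ (GroupPseudovariety.allFinite.topology _) (V.proj A) x H

theorem verbalSubgroup_le_closure {A : Type u} (H : Subgroup (FreeGroup A)) :
    V.verbalSubgroup A ≤ V.finiteTrace.closure H := by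
  rw [closure_finiteTrace_eq_comap]
  intro x hx
  have : V.proj A x = 1 := (QuotientGroup.eq_one_iff x).2 hx
  rw [Subgroup.mem_comap, this]
  exact one_mem _

/-- If the free group is relatively free, then finitely generated subgroups are closed. -/
theorem closure_finiteTrace_eq_of_verbalSubgroup_eq_bot {A : Type u}
    (hA : V.verbalSubgroup A = ⊥) {H : Subgroup (FreeGroup A)} (hH : H.FG) :
    V.finiteTrace.closure H = H :=
  GroupPseudovariety.closure_eq_of_exists _ fun x hx => by
    obtain ⟨P, hP, hHP, hxP⟩ := FreeGroup.exists_finiteIndex_notMem hH hx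
    refine ⟨P, hHP, hxP, ?_, inferInstanceAs (Finite (FreeGroup A ⧸ P.normalCore))⟩
    refine V.image_mem _ _ (QuotientGroup.lift (V.verbalSubgroup A) (QuotientGroup.mk' P.normalCore)
      (by rw [hA]; exact bot_le)) ?_ (V.mem_quotient_verbalSubgroup A)
    exact QuotientGroup.lift_surjective_of_surjective _ _ (QuotientGroup.mk'_surjective _) _

theorem closure_finiteTrace_eq_of_isAllGroups (hV : V.IsAllGroups) {A : Type u}
    {H : Subgroup (FreeGroup A)} (hH : H.FG) : V.finiteTrace.closure H = H :=
  GroupPseudovariety.closure_eq_of_exists _ fun x hx => by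
    obtain ⟨P, hP, hHP, hxP⟩ := FreeGroup.exists_finiteIndex_notMem hH hx
    exact ⟨P, hHP, hxP, hV _, inferInstanceAs (Finite (FreeGroup A ⧸ P.normalCore))⟩

theorem finiteIndex_of_verbalSubgroup_le {A : Type u} (hA : V.verbalSubgroup A ≠ ⊥)
    {C : Subgroup (FreeGroup A)} (hC : C.FG) (hle : V.verbalSubgroup A ≤ C) : C.FiniteIndex :=
  FreeGroup.finiteIndex_of_normal_le hC hA hle

/-- The generators of `C` use a finite set `B` of letters, so `C` dies under the retraction `r`
killing `B`. An element of `F_A^V` can be rewritten in letters outside `B`; the result still lies in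
`F_A^V ≤ C`, yet `r` fixes it, so it is trivial. -/
theorem verbalSubgroup_eq_bot_of_le_fg {A : Type u} [Infinite A] {C : Subgroup (FreeGroup A)}
    (hC : C.FG) (hle : V.verbalSubgroup A ≤ C) : V.verbalSubgroup A = ⊥ := by
  classical
  obtain ⟨S, rfl⟩ := hC
  let B : Finset A := S.biUnion fun s => (s.toWord.map Prod.fst).toFinset
  let r : FreeGroup A →* FreeGroup A :=
    FreeGroup.lift fun a => if a ∈ B then 1 else FreeGroup.of a
  have hr : Subgroup.closure (S : Set (FreeGroup A)) ≤ r.ker := by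
    rw [Subgroup.closure_le]
    intro s hs
    have := FreeGroup.hom_mk_congr r 1 s.toWord fun p hp => by
      have : p.1 ∈ B := Finset.mem_biUnion.2
        ⟨s, hs, List.mem_toFinset.2 (List.mem_map_of_mem hp)⟩
      simp [r, this]
    rwa [FreeGroup.mk_toWord] at this
  have hcard : Cardinal.mk A = Cardinal.mk ((B : Set A)ᶜ : Set A) :=
    (Cardinal.mk_compl_finset_of_infinite B).symm
  obtain ⟨e⟩ := Cardinal.eq.1 hcard
  rw [eq_bot_iff]
  intro x hx
  have h1 : r (FreeGroup.map (fun a => (e a : A)) x) = 1 :=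
    hr (hle (V.map_mem_verbalSubgroup (FreeGroup.map fun a => (e a : A)) hx))
  have h2 : r.comp (FreeGroup.map fun a => (e a : A)) = FreeGroup.map fun a => (e a : A) := by
    ext a
    have : (e a : A) ∉ B := (e a).2
    simp [r, this]
  rw [← MonoidHom.comp_apply, h2] at h1
  exact FreeGroup.map_injective (Subtype.val_injective.comp e.injective)
    (by rw [_root_.map_one]; exact h1)

theorem closure_fg_iff_of_infinite {A : Type u} [Infinite A] {H : Subgroup (FreeGroup A)}
    (hH : H.FG) : (V.finiteTrace.closure H).FG ↔ V.IsAllGroups :=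
  ⟨fun h => V.isAllGroups_of_verbalSubgroup_eq_bot
      (V.verbalSubgroup_eq_bot_of_le_fg h (V.verbalSubgroup_le_closure H)),
    fun hV => by rwa [V.closure_finiteTrace_eq_of_isAllGroups hV hH]⟩

/-- If `F_A^V = 1` and `V` is not everything, the rank is at most one. In rank one `F_A` is infinite
cyclic, so a nontrivial `H` is itself normal and forces finite index; for `H = 1` the closure is
trivial, which is the excluded case. -/
theorem closure_fg_iff_of_finite {A : Type u} [Finite A] {H : Subgroup (FreeGroup A)}
    (hH : H.FG)
    (hexc : ¬ (Nat.card A = 1 ∧ H = ⊥ ∧ V.verbalSubgroup A = ⊥ ∧ ¬ V.IsAllGroups)) :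
    (V.finiteTrace.closure H).FG ↔ V.IsAllGroups ∨ (V.finiteTrace.closure H).FiniteIndex := by
  constructor
  · intro h
    by_cases hV : V.IsAllGroups
    · exact Or.inl hV
    right
    by_cases hA : V.verbalSubgroup A = ⊥
    · have hsub : ¬ Nontrivial A := fun _ => hV (V.isAllGroups_of_verbalSubgroup_eq_bot hA)
      rw [not_nontrivial_iff_subsingleton] at hsub
      rcases isEmpty_or_nonempty A with hE | hE
      · infer_instance
      · have hcard : Nat.card A = 1 := Nat.card_eq_one_iff_unique.2 ⟨hsub, hE⟩
        have hH0 : H ≠ ⊥ := fun h0 => hexc ⟨hcard, h0, hA, hV⟩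
        have : Unique A := Nat.card_eq_one_iff_unique.1 hcard |>.2.some |> fun a =>
          ⟨⟨a⟩, fun b => Subsingleton.elim b a⟩
        have hcomm : ∀ x y : FreeGroup A, x * y = y * x := by
          intro x y
          apply (FreeGroup.mulEquivIntOfUnique (α := A)).injective
          rw [_root_.map_mul, _root_.map_mul, mul_comm]
        have : H.Normal := ⟨fun n hn g => by rwa [hcomm g n, mul_inv_cancel_right]⟩
        exact FreeGroup.finiteIndex_of_normal_le h hH0 (V.finiteTrace.le_closure H)
    · exact V.finiteIndex_of_verbalSubgroup_le hA h (V.verbalSubgroup_le_closure H)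
  · rintro (hV | hfi)
    · rwa [V.closure_finiteTrace_eq_of_isAllGroups hV hH]
    · exact (Group.fg_iff_subgroup_fg _).1 inferInstance

end GroupVariety

/-! ### Finite groups and homomorphisms encoded by tables -/

/-- Words in countably many letters and their inverses. -/
abbrev GroupWord := List (ℕ × Bool)

namespace MulTable

/-- The entry of a table in a given row and column. -/
def entry (M : List (List ℕ)) (i j : ℕ) : ℕ :=
  (M.getD i []).getD j 0

/-- The index of a letter or an inverse letter, when `c` lists the indices of the letters and of
their inverses and the remaining letters have index `z`. -/
def letterIndex (z : ℕ) (c : List (ℕ × ℕ)) (p : ℕ × Bool) : ℕ :=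
  bif p.2 then (c.getD p.1 (z, z)).1 else (c.getD p.1 (z, z)).2

/-- The action of words on indices by multiplication from the left. -/
def act (M : List (List ℕ)) (z : ℕ) (c : List (ℕ × ℕ)) (w : GroupWord) (i : ℕ) : ℕ :=
  w.foldr (fun p j => entry M (letterIndex z c p) j) i

/-- `M` satisfies the laws of the multiplication table of a group with neutral element `z`. -/
def IsGroupTable (M : List (List ℕ)) (z : ℕ) : Prop :=
  (∀ r ∈ M, r.length = M.length) ∧ z < M.length ∧
  (∀ i < M.length, entry M z i = i ∧ ∃ j < M.length, entry M j i = z) ∧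
  ∀ i < M.length, ∀ j < M.length, entry M i j < M.length ∧
    ∀ k < M.length, entry M (entry M i j) k = entry M i (entry M j k)

/-- `c` lists the indices of at most `n` group elements together with those of their inverses. -/
def IsMarking (n : ℕ) (M : List (List ℕ)) (z : ℕ) (c : List (ℕ × ℕ)) : Prop :=
  c.length ≤ n ∧ ∀ p ∈ c, p.1 < M.length ∧ p.2 < M.length ∧ entry M p.1 p.2 = z

/-- The enumeration `e` of `G` has the multiplication table `M`. -/
def IsTableBy (M : List (List ℕ)) {G : Type u} [Group G] (e : G ≃ Fin M.length) : Prop :=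
  ∀ a b : G, (M[(e a : ℕ)]?.bind fun r => r[(e b : ℕ)]?) = some (e (a * b) : ℕ)

theorem exists_eq_of_lt {M : List (List ℕ)} {G : Type u} (e : G ≃ Fin M.length) {i : ℕ}
    (hi : i < M.length) : ∃ g : G, (e g : ℕ) = i :=
  ⟨e.symm ⟨i, hi⟩, by simp⟩

section

variable {M : List (List ℕ)} {G : Type u} [Group G] {e : G ≃ Fin M.length}

theorem IsTableBy.entry_eq (h : IsTableBy M e) (a b : G) : entry M (e a) (e b) = e (a * b) := by
  have := h a b
  rw [Option.bind_eq_some_iff] at this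
  obtain ⟨r, hr, hb⟩ := this
  rw [entry, List.getD_eq_getElem?_getD, List.getD_eq_getElem?_getD, hr, Option.getD_some, hb,
    Option.getD_some]

theorem IsTableBy.isGroupTable (h : IsTableBy M e) (hM : ∀ r ∈ M, r.length = M.length) :
    IsGroupTable M (e 1) := by
  refine ⟨hM, (e 1).2, fun i hi => ?_, fun i hi j hj => ?_⟩
  · obtain ⟨g, rfl⟩ := exists_eq_of_lt e hi
    exact ⟨by rw [h.entry_eq, one_mul], e g⁻¹, (e g⁻¹).2, by rw [h.entry_eq, inv_mul_cancel]⟩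
  · obtain ⟨g, rfl⟩ := exists_eq_of_lt e hi
    obtain ⟨g', rfl⟩ := exists_eq_of_lt e hj
    refine ⟨by rw [h.entry_eq]; exact (e _).2, fun k hk => ?_⟩
    obtain ⟨g'', rfl⟩ := exists_eq_of_lt e hk
    simp only [h.entry_eq, mul_assoc]

theorem IsTableBy.nonempty_mulEquiv {G' : Type u} [Group G'] {e' : G' ≃ Fin M.length}
    (h : IsTableBy M e) (h' : IsTableBy M e') : Nonempty (G ≃* G') := by
  refine ⟨⟨e.trans e'.symm, fun a b => ?_⟩⟩
  apply e'.injective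
  apply Fin.ext
  have h1 := h'.entry_eq (e'.symm (e a)) (e'.symm (e b))
  simp only [Equiv.apply_symm_apply, h.entry_eq] at h1
  simpa using h1

end

/-- A table rejected by the membership test for `V^f` is informative only if it is the table of some
group; the checkable laws ensure this. -/
theorem IsGroupTable.exists_group {M : List (List ℕ)} {z : ℕ} (h : IsGroupTable M z) :
    ∃ (G : Type u) (_ : Group G) (e : G ≃ Fin M.length), IsTableBy M e ∧ (e 1 : ℕ) = z := by
  obtain ⟨hrow, hz, hone, hmul⟩ := h
  let e : ULift.{u} (Fin M.length) ≃ Fin M.length := Equiv.ulift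
  let iM : Mul (ULift.{u} (Fin M.length)) :=
    ⟨fun a b => ⟨⟨entry M a.down b.down, (hmul _ a.down.2 _ b.down.2).1⟩⟩⟩
  let iO : One (ULift.{u} (Fin M.length)) := ⟨⟨⟨z, hz⟩⟩⟩
  choose j hj using fun a : ULift.{u} (Fin M.length) => (hone _ a.down.2).2
  let iI : Inv (ULift.{u} (Fin M.length)) := ⟨fun a => ⟨⟨j a, (hj a).1⟩⟩⟩
  let iG : Group (ULift.{u} (Fin M.length)) := Group.ofLeftAxioms
    (fun a b c => ULift.ext _ _ (Fin.ext ((hmul _ a.down.2 _ b.down.2).2 _ c.down.2)))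
    (fun a => ULift.ext _ _ (Fin.ext (hone _ a.down.2).1))
    (fun a => ULift.ext _ _ (Fin.ext (hj a).2))
  refine ⟨_, iG, e, fun a b => ?_, rfl⟩
  have ha : (e a : ℕ) < M.length := (e a).2
  have hb : (e b : ℕ) < (M[(e a : ℕ)]).length := by
    rw [hrow _ (List.getElem_mem ha)]
    exact (e b).2
  have : (e (a * b) : ℕ) = entry M (e a) (e b) := rfl
  rw [this, entry]
  simp [hb]

theorem exists_isTableBy (G : Type u) [Group G] [Finite G] :
    ∃ (M : List (List ℕ)) (e : G ≃ Fin M.length),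
      (∀ r ∈ M, r.length = M.length) ∧ IsTableBy M e := by
  obtain ⟨n, ⟨e⟩⟩ := Finite.exists_equiv_fin G
  let M : List (List ℕ) :=
    List.ofFn fun i : Fin n => List.ofFn fun j : Fin n => (e (e.symm i * e.symm j) : ℕ)
  have hM : M.length = n := by simp [M]
  refine ⟨M, e.trans (finCongr hM.symm), ?_, fun a b => ?_⟩
  · intro r hr
    obtain ⟨i, rfl⟩ := (List.mem_ofFn' _ _).1 hr
    simp [M]
  · simp [M]

section

variable {M : List (List ℕ)} {G : Type u} [Group G] {e : G ≃ Fin M.length} {z n : ℕ}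
  {c : List (ℕ × ℕ)}

/-- A marking of a multiplication table of `G` is a homomorphism to `G`. -/
theorem IsTableBy.exists_hom (h : IsTableBy M e) (hz : (e 1 : ℕ) = z) (hc : IsMarking n M z c) :
    ∃ φ : FreeGroup ℕ →* G, (∀ a, n ≤ a → φ (FreeGroup.of a) = 1) ∧
      (∀ a, (e (φ (FreeGroup.of a)) : ℕ) = letterIndex z c (a, true)) ∧
      ∀ (w : GroupWord) (g : G), act M z c w (e g) = e (φ (FreeGroup.mk w) * g) := by
  have key : ∀ a, ∃ g : G, (e g : ℕ) = letterIndex z c (a, true) ∧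
      (e g⁻¹ : ℕ) = letterIndex z c (a, false) ∧ (n ≤ a → g = 1) := by
    intro a
    by_cases ha : a < c.length
    · obtain ⟨h1, h2, h3⟩ := hc.2 _ (List.getElem_mem ha)
      obtain ⟨g, hg⟩ := exists_eq_of_lt e h1
      obtain ⟨g', hg'⟩ := exists_eq_of_lt e h2
      rw [← hg, ← hg', h.entry_eq, ← hz, Fin.val_inj, e.apply_eq_iff_eq] at h3
      rw [← inv_eq_of_mul_eq_one_right h3] at hg'
      exact ⟨g, by simp [letterIndex, ha, hg], by simp [letterIndex, ha, hg'],
        fun hn => absurd (hc.1.trans hn) (not_le.2 ha)⟩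
    · refine ⟨1, ?_⟩
      simp [letterIndex, List.getElem?_eq_none (not_lt.1 ha), hz]
  choose f hf using key
  refine ⟨FreeGroup.lift f, fun a ha => by simpa using (hf a).2.2 ha, fun a => by simp [hf a],
    fun w g => ?_⟩
  induction w with
  | nil => simp [act, ← FreeGroup.one_eq_mk]
  | cons p w ih =>
    have hmul : FreeGroup.mk (p :: w) = FreeGroup.mk [p] * FreeGroup.mk w := by
      simp [FreeGroup.mul_mk]
    have hact : act M z c (p :: w) (e g) = entry M (letterIndex z c p) (act M z c w (e g)) := rfl
    have hp : (e (FreeGroup.lift f (FreeGroup.mk [p])) : ℕ) = letterIndex z c p := by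
      obtain ⟨a, _ | _⟩ := p
      · simp [(hf a).2.1]
      · simp [(hf a).1]
    rw [hact, ih, ← hp, h.entry_eq, hmul, _root_.map_mul (FreeGroup.lift f), mul_assoc]

end

end MulTable

/-! ### Certificates for being closed and for not being closed -/

open MulTable

/-- `w` represents an element of the subgroup generated by the words in `L`, and `q` shows how. -/
def IsFactorization (L : List GroupWord) (q : List GroupWord) (w : GroupWord) : Prop :=
  (∀ v ∈ q, v ∈ L ∨ FreeGroup.invRev v ∈ L) ∧
    FreeGroup.reduce q.flatten = FreeGroup.reduce w

/-- Membership in a finitely generated subgroup thus has witnesses that can be checked by free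
reduction. -/
theorem exists_isFactorization_iff (L : List GroupWord) (w : GroupWord) :
    (∃ q, IsFactorization L q w) ↔
      FreeGroup.mk w ∈ Subgroup.closure {g : FreeGroup ℕ | ∃ v ∈ L, g = FreeGroup.mk v} := by
  constructor
  · rintro ⟨q, hq, hw⟩
    rw [← FreeGroup.reduce.exact hw]
    clear hw
    induction q with
    | nil => exact one_mem _
    | cons v q ih =>
      rw [List.flatten_cons, ← FreeGroup.mul_mk]
      refine mul_mem ?_ (ih fun v' hv' => hq v' (List.mem_cons_of_mem _ hv'))
      rcases hq v List.mem_cons_self with h | h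
      · exact Subgroup.subset_closure ⟨v, h, rfl⟩
      · rw [← inv_mem_iff, FreeGroup.inv_mk]
        exact Subgroup.subset_closure ⟨_, h, rfl⟩
  · intro h
    rw [← Subgroup.mem_toSubmonoid, Subgroup.closure_toSubmonoid] at h
    obtain ⟨l, hl, hw⟩ := Submonoid.exists_list_of_mem_closure h
    have : ∃ q : List GroupWord, (∀ v ∈ q, v ∈ L ∨ FreeGroup.invRev v ∈ L) ∧
        FreeGroup.mk q.flatten = l.prod := by
      clear hw
      induction l with
      | nil => exact ⟨[], by simp [FreeGroup.one_eq_mk]⟩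
      | cons y l ih =>
        obtain ⟨q, hq, hql⟩ := ih fun y hy => hl y (List.mem_cons_of_mem _ hy)
        obtain ⟨v, hv, rfl⟩ : ∃ v : GroupWord, (v ∈ L ∨ FreeGroup.invRev v ∈ L) ∧
            y = FreeGroup.mk v := by
          rcases hl y List.mem_cons_self with ⟨v, hv, rfl⟩ | ⟨v, hv, hy⟩
          · exact ⟨v, Or.inl hv, rfl⟩
          · exact ⟨FreeGroup.invRev v, Or.inr (by rwa [FreeGroup.invRev_invRev]), by
              rw [← FreeGroup.inv_mk, ← hy, inv_inv]⟩
        refine ⟨v :: q, ?_, ?_⟩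
        · simpa [hv] using hq
        · rw [List.flatten_cons, ← FreeGroup.mul_mk, hql, List.prod_cons]
    obtain ⟨q, hq, hql⟩ := this
    exact ⟨q, hq, FreeGroup.reduce.sound (hql.trans hw)⟩

/-- `S` is a transversal for the subgroup generated by the words in `L`, up to repetitions, on which
the first `n` letters act as on the marked table `M`. -/
def IsSchreierSystem (n : ℕ) (L : List GroupWord) (M : List (List ℕ)) (z : ℕ) (c : List (ℕ × ℕ))
    (S : List GroupWord) (Q : List (List GroupWord)) : Prop :=
  S.getD z [] = [] ∧ ∀ a < n, ∀ i < M.length, ∃ q ∈ Q,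
    IsFactorization L q (FreeGroup.invRev (S.getD (entry M (letterIndex z c (a, true)) i) []) ++
      (a, true) :: S.getD i [])

/-- `J` contains the neutral element, is stable under the words in `L`, and contains no set of
conjugates of a nontrivial element; and `S` lists words for all group elements. -/
def IsCoreFree (L : List GroupWord) (M : List (List ℕ)) (z : ℕ) (c : List (ℕ × ℕ))
    (S : List GroupWord) (J : List ℕ) : Prop :=
  (∀ i < M.length, act M z c (S.getD i []) z = i) ∧ z ∈ J ∧
  (∀ w ∈ L, ∀ j ∈ J, act M z c w j ∈ J ∧ act M z c (FreeGroup.invRev w) j ∈ J) ∧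
  ∀ i < M.length, i = z ∨ ∃ k < M.length,
    act M z c (FreeGroup.invRev (S.getD k []) ++ (S.getD i [] ++ S.getD k [])) z ∉ J

namespace FreeGroup

variable {n : ℕ} {A : Type*} (e : Fin n ≃ A)

/-- The retraction of a free group of countable rank onto the free group on an enumerated finite
alphabet. -/
def ofNatLetters : FreeGroup ℕ →* FreeGroup A :=
  lift fun a => if h : a < n then of (e ⟨a, h⟩) else 1

/-- The embedding of the free group on an enumerated finite alphabet into a free group of countable
rank. -/
def toNatLetters : FreeGroup A →* FreeGroup ℕ :=
  map fun x => (e.symm x : ℕ)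

@[simp]
theorem ofNatLetters_of (i : Fin n) : ofNatLetters e (of (i : ℕ)) = of (e i) := by
  simp [ofNatLetters]

theorem ofNatLetters_of_le {a : ℕ} (h : n ≤ a) : ofNatLetters e (of a) = 1 := by
  simp [ofNatLetters, h]

@[simp]
theorem toNatLetters_of (x : A) : toNatLetters e (of x) = of (e.symm x : ℕ) := by
  simp [toNatLetters]

@[simp]
theorem ofNatLetters_toNatLetters (x : FreeGroup A) :
    ofNatLetters e (toNatLetters e x) = x := by
  have : (ofNatLetters e).comp (toNatLetters e) = MonoidHom.id _ := by
    ext x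
    simp
  exact DFunLike.congr_fun this x

theorem closure_mk_eq_map_toNatLetters (L : List (List (Fin n × Bool))) :
    Subgroup.closure {g : FreeGroup ℕ | ∃ v ∈ L.map fun w => w.map fun x => ((x.1 : ℕ), x.2),
      g = mk v} = (subgroupOfWords e L).map (toNatLetters e) := by
  rw [subgroupOfWords, MonoidHom.map_closure]
  congr 1
  ext g
  simp [toNatLetters, Function.comp_def, Set.image, eq_comm]

theorem subgroupOfWords_eq_map_ofNatLetters (L : List (List (Fin n × Bool))) :
    subgroupOfWords e L = (Subgroup.closure {g : FreeGroup ℕ |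
      ∃ v ∈ L.map fun w => w.map fun x => ((x.1 : ℕ), x.2), g = mk v}).map (ofNatLetters e) := by
  have : (ofNatLetters e).comp (toNatLetters e) = MonoidHom.id _ := by
    ext x
    simp
  rw [closure_mk_eq_map_toNatLetters e, Subgroup.map_map, this, Subgroup.map_id]

/-- If `s` picks a representative of every left coset that occurs, in a way compatible with the
action of the letters, then the kernel of the action lies in the subgroup. -/
theorem ker_le_of_transversal {A G : Type*} [Group G] (φ : FreeGroup A →* G)
    {H : Subgroup (FreeGroup A)} (s : G → FreeGroup A) (h1 : s 1 = 1)
    (hs : ∀ a g, (s (φ (of a) * g))⁻¹ * (of a * s g) ∈ H) : φ.ker ≤ H := by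
  -- The coset condition passes from letters to products and inverses; at `g = 1` and `x` in the
  -- kernel it says `x ∈ H`.
  have key : ∀ x g, (s (φ x * g))⁻¹ * (x * s g) ∈ H := by
    intro x
    induction x using FreeGroup.induction_on with
    | C1 => simp
    | of a => exact hs a
    | inv_of a _ =>
      intro g
      have := H.inv_mem (hs a ((φ (of a))⁻¹ * g))
      rw [mul_inv_cancel_left] at this
      simpa [mul_assoc] using this
    | mul x y hx hy =>
      intro g
      have := H.mul_mem (hx (φ y * g)) (hy g)
      simpa [mul_assoc] using this
  intro x hx
  have := key x 1
  rwa [MonoidHom.mem_ker.1 hx, mul_one, h1, inv_one, one_mul, mul_one] at this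

end FreeGroup

open FreeGroup

theorem subgroupOfWords_fg {A B : Type*} (ν : B → A) (L : List (List (B × Bool))) :
    (subgroupOfWords ν L).FG := by
  classical
  refine ⟨(L.map fun w => FreeGroup.mk (w.map fun x => (ν x.1, x.2))).toFinset, ?_⟩
  rw [subgroupOfWords]
  congr 1
  ext g
  simp [eq_comm]

namespace GroupVariety

variable (V : GroupVariety.{u}) {n : ℕ} {A : Type u} (e : Fin n ≃ A)
  {M : List (List ℕ)} {z : ℕ} {c : List (ℕ × ℕ)} {S : List GroupWord}

theorem exists_hom_of_isMarking {G : Type u} [Group G] {ε : G ≃ Fin M.length}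
    (hε : IsTableBy M ε) (hz : (ε 1 : ℕ) = z) (hc : IsMarking n M z c) :
    ∃ φ : FreeGroup A →* G,
      (∀ i : Fin n, (ε (φ (of (e i))) : ℕ) = letterIndex z c ((i : ℕ), true)) ∧
      ∀ (w : GroupWord) (g : G), act M z c w (ε g) = ε (φ (ofNatLetters e (FreeGroup.mk w)) * g) := by
  obtain ⟨φ, h1, h2, h3⟩ := hε.exists_hom hz hc
  have hcomp : (φ.comp (toNatLetters e)).comp (ofNatLetters e) = φ := by
    ext a
    by_cases ha : a < n
    · simpa using congrArg (fun y => φ (toNatLetters e y)) (ofNatLetters_of e ⟨a, ha⟩)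
    · simp [ofNatLetters_of_le e (not_lt.1 ha), h1 a (not_lt.1 ha)]
  refine ⟨φ.comp (toNatLetters e), fun i => by simp [h2], fun w g => ?_⟩
  rw [h3, ← MonoidHom.comp_apply, hcomp]

/-- Soundness of positive certificates: the transversal puts the kernel of a homomorphism to a group
of `V^f` inside the subgroup. -/
theorem isClosedSubgroup_of_isSchreierSystem {L : List (List (Fin n × Bool))}
    {Q : List (List GroupWord)} (hT : IsGroupTable M z) (hc : IsMarking n M z c)
    (hS : IsSchreierSystem n (L.map fun w => w.map fun x => ((x.1 : ℕ), x.2)) M z c S Q)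
    (hM : ∃ (G : Type u) (_ : Group G),
      GroupPseudovariety.IsMulTable M G ∧ V.finiteTrace.Mem G) :
    V.finiteTrace.IsClosedSubgroup (subgroupOfWords e L) := by
  obtain ⟨G, _, ⟨-, ε, hε⟩, hG⟩ := hM
  have hε : IsTableBy M ε := hε
  -- The enumeration `ε` comes without a base point, but `z` is idempotent in the table, hence the
  -- index of `1`.
  have hz : (ε 1 : ℕ) = z := by
    obtain ⟨g, hg⟩ := exists_eq_of_lt ε hT.2.1
    have h1 := (hT.2.2.1 z hT.2.1).1
    rw [← hg, hε.entry_eq, Fin.val_inj, ε.apply_eq_iff_eq, mul_eq_left] at h1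
    rw [← hg, h1]
  obtain ⟨φ, hφ, -⟩ := exists_hom_of_isMarking e hε hz hc
  refine GroupPseudovariety.isClosedSubgroup_of_ker_le _ hG φ ?_
  refine ker_le_of_transversal φ (fun g => ofNatLetters e (FreeGroup.mk (S.getD (ε g) []))) ?_ ?_
  · rw [hz, hS.1, ← one_eq_mk, _root_.map_one]
  · intro a g
    obtain ⟨i, rfl⟩ := e.surjective a
    obtain ⟨q, -, hq⟩ := hS.2 i i.2 (ε g) (ε g).2
    have hmem := (exists_isFactorization_iff _ _).1 ⟨q, hq⟩
    rw [← hφ, hε.entry_eq] at hmem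
    have := Subgroup.mem_map_of_mem (ofNatLetters e) hmem
    rw [← subgroupOfWords_eq_map_ofNatLetters] at this
    have hcons : FreeGroup.mk (((i : ℕ), true) :: S.getD (ε g) []) =
        of (i : ℕ) * FreeGroup.mk (S.getD (ε g) []) := by
      simp [of, mul_mk]
    rwa [← mul_mk, hcons, ← inv_mk, _root_.map_mul (ofNatLetters e), _root_.map_mul (ofNatLetters e),
      _root_.map_inv,
      ofNatLetters_of] at this

/-- Soundness of negative certificates: a closed `H` contains `F_A^V`, so `F_A^V` preserves `J`. As
`F_A^V` is normal, all conjugates of its images lie in `J`, so these images are trivial; then `G` is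
a quotient of the relatively free group and lies in `V`. -/
theorem not_isClosedSubgroup_of_isCoreFree {L : List (List (Fin n × Bool))} {J : List ℕ}
    (hT : IsGroupTable M z) (hc : IsMarking n M z c)
    (hJ : IsCoreFree (L.map fun w => w.map fun x => ((x.1 : ℕ), x.2)) M z c S J)
    (hM : ¬ ∃ (G : Type u) (_ : Group G),
      GroupPseudovariety.IsMulTable M G ∧ V.finiteTrace.Mem G) :
    ¬ V.finiteTrace.IsClosedSubgroup (subgroupOfWords e L) := by
  intro hcl
  obtain ⟨G, _, ε, hε, hz⟩ := hT.exists_group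
  obtain ⟨φ, -, hact⟩ := exists_hom_of_isMarking e hε hz hc
  obtain ⟨hJ1, hJ2, hJ3, hJ4⟩ := hJ
  have hact1 : ∀ w, act M z c w z = ε (φ (ofNatLetters e (FreeGroup.mk w))) := by
    intro w
    have := hact w 1
    rwa [hz, mul_one] at this
  have hS : ∀ g, φ (ofNatLetters e (FreeGroup.mk (S.getD (ε g) []))) = g := by
    intro g
    have h1 := hJ1 (ε g) (ε g).2
    rwa [hact1, Fin.val_inj, ε.apply_eq_iff_eq] at h1
  have hle : V.verbalSubgroup A ≤ subgroupOfWords e L := by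
    rw [GroupPseudovariety.isClosedSubgroup_iff] at hcl
    rw [← hcl]
    exact V.verbalSubgroup_le_closure _
  have hHJ : ∀ h ∈ subgroupOfWords e L, ∀ g, (ε g : ℕ) ∈ J ↔ (ε (φ h * g) : ℕ) ∈ J := by
    intro h hh
    rw [subgroupOfWords_eq_map_ofNatLetters] at hh
    obtain ⟨h, hh, rfl⟩ := hh
    induction hh using Subgroup.closure_induction with
    | mem x hx =>
      obtain ⟨w, hw, rfl⟩ := hx
      intro g
      rw [← hact]
      refine ⟨fun hg => (hJ3 w hw _ hg).1, fun hg => ?_⟩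
      have := (hJ3 w hw _ hg).2
      rwa [hact, hact, ← inv_mk, _root_.map_inv, _root_.map_inv, inv_mul_cancel_left] at this
    | one => simp
    | mul x y _ _ hx hy =>
      intro g
      rw [hy g, hx, _root_.map_mul (ofNatLetters e), _root_.map_mul φ, mul_assoc]
    | inv x _ hx =>
      intro g
      rw [hx (φ _ * g), _root_.map_inv, _root_.map_inv, mul_inv_cancel_left]
  have hker : V.verbalSubgroup A ≤ φ.ker := by
    intro x hx
    have h1 := hJ4 (ε (φ x)) (ε (φ x)).2
    rcases h1 with h1 | ⟨k, hk, h1⟩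
    · rwa [← hz, Fin.val_inj, ε.apply_eq_iff_eq] at h1
    · exfalso
      obtain ⟨g, rfl⟩ := exists_eq_of_lt ε hk
      apply h1
      have hconj : (ofNatLetters e (FreeGroup.mk (S.getD (ε g) [])))⁻¹ * x *
          ofNatLetters e (FreeGroup.mk (S.getD (ε g) [])) ∈ V.verbalSubgroup A := by
        simpa using (inferInstance : (V.verbalSubgroup A).Normal).conj_mem x hx
          (ofNatLetters e (FreeGroup.mk (S.getD (ε g) [])))⁻¹
      have h2 := (hHJ _ (hle hconj) 1).1 (by rwa [hz])
      rw [hact1, ← mul_mk, ← mul_mk, ← inv_mk]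
      rw [mul_one, _root_.map_mul φ, _root_.map_mul φ, _root_.map_inv, hS, mul_assoc] at h2
      simpa only [_root_.map_mul (ofNatLetters e), _root_.map_mul φ, _root_.map_inv, hS] using h2
  refine hM ⟨G, _, ⟨hT.1, ε, hε⟩, ?_, Finite.of_equiv _ ε.symm⟩
  refine V.image_mem _ _ (QuotientGroup.lift _ φ hker) ?_ (V.mem_quotient_verbalSubgroup A)
  exact QuotientGroup.lift_surjective_of_surjective _ _ (fun g => ⟨_, hS g⟩) _

end GroupVariety

section

variable {n : ℕ} {A : Type u} (e : Fin n ≃ A)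

/-- Every finite quotient of a free group of finite rank is described by a marked multiplication
table, together with words for its elements. -/
theorem exists_marked_table (K : Subgroup (FreeGroup A)) [K.Normal] [K.FiniteIndex] :
    ∃ (M : List (List ℕ)) (c : List (ℕ × ℕ)) (S : List GroupWord)
      (ε : FreeGroup A ⧸ K ≃ Fin M.length) (s : FreeGroup A ⧸ K → FreeGroup A),
      (∀ r ∈ M, r.length = M.length) ∧ IsTableBy M ε ∧ IsMarking n M (ε 1) c ∧ s 1 = 1 ∧
      (∀ g, QuotientGroup.mk' K (s g) = g) ∧
      (∀ g, S.getD (ε g) [] = (toNatLetters e (s g)).toWord) ∧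
      (∀ i : Fin n, letterIndex (ε 1) c ((i : ℕ), true) = ε (QuotientGroup.mk' K (of (e i)))) ∧
      ∀ (w : GroupWord) (g : FreeGroup A ⧸ K),
        act M (ε 1) c w (ε g) = ε (QuotientGroup.mk' K (ofNatLetters e (mk w)) * g) := by
  classical
  obtain ⟨M, ε, hM, hε⟩ := exists_isTableBy (FreeGroup A ⧸ K)
  let γ (i : Fin n) : FreeGroup A ⧸ K := QuotientGroup.mk' K (of (e i))
  let c : List (ℕ × ℕ) := List.ofFn fun i : Fin n => ((ε (γ i) : ℕ), (ε (γ i)⁻¹ : ℕ))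
  let s (g : FreeGroup A ⧸ K) : FreeGroup A := if g = 1 then 1 else g.out
  have hs : ∀ g, QuotientGroup.mk' K (s g) = g := by
    intro g
    by_cases hg : g = 1
    · simp [s, hg]
    · simp [s, hg]
  have hc : IsMarking n M (ε 1) c := by
    refine ⟨by simp [c], fun p hp => ?_⟩
    obtain ⟨i, rfl⟩ := (List.mem_ofFn' _ _).1 hp
    exact ⟨(ε _).2, (ε _).2, by rw [hε.entry_eq, mul_inv_cancel]⟩
  have hγ : ∀ i : Fin n, letterIndex (ε 1) c ((i : ℕ), true) = ε (γ i) := by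
    intro i
    simp [letterIndex, c]
  refine ⟨M, c, List.ofFn fun i => (toNatLetters e (s (ε.symm i))).toWord, ε, s, hM, hε, hc,
    by simp [s], hs, fun g => by simp, hγ, ?_⟩
  obtain ⟨φ, h1, h2⟩ := GroupVariety.exists_hom_of_isMarking e hε rfl hc
  have hφ : φ = QuotientGroup.mk' K := by
    ext a
    obtain ⟨i, rfl⟩ := e.surjective a
    have := h1 i
    rwa [hγ, Fin.val_inj, ε.apply_eq_iff_eq] at this
  rwa [hφ] at h2

end

namespace GroupVariety

variable (V : GroupVariety.{u}) {n : ℕ} {A : Type u} (e : Fin n ≃ A)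

theorem exists_mem_of_isMulTable_iff {M : List (List ℕ)} {G : Type u} [Group G]
    {ε : G ≃ Fin M.length} (hM : ∀ r ∈ M, r.length = M.length) (hε : IsTableBy M ε) :
    (∃ (G : Type u) (_ : Group G), GroupPseudovariety.IsMulTable M G ∧ V.finiteTrace.Mem G) ↔
      V.Mem G := by
  constructor
  · rintro ⟨G', _, ⟨-, ε', hε'⟩, hG'⟩
    obtain ⟨i⟩ := hε.nonempty_mulEquiv (e' := ε') hε'
    exact V.mem_of_injective i.toMonoidHom i.injective hG'.1
  · exact fun h => ⟨G, _, ⟨hM, ε, hε⟩, h, Finite.of_equiv _ ε.symm⟩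

/-- Completeness of positive certificates: a closed `H` contains `F_A^V ≠ 1`, so it has finite
index, and `F_A/core(H)` lies in `V` because `F_A^V ≤ core(H)`. -/
theorem exists_isSchreierSystem (hA : V.verbalSubgroup A ≠ ⊥)
    (L : List (List (Fin n × Bool)))
    (hcl : V.finiteTrace.IsClosedSubgroup (subgroupOfWords e L)) :
    ∃ (M : List (List ℕ)) (z : ℕ) (c : List (ℕ × ℕ)) (S : List GroupWord)
      (Q : List (List GroupWord)), IsGroupTable M z ∧ IsMarking n M z c ∧
      IsSchreierSystem n (L.map fun w => w.map fun x => ((x.1 : ℕ), x.2)) M z c S Q ∧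
      ∃ (G : Type u) (_ : Group G), GroupPseudovariety.IsMulTable M G ∧ V.finiteTrace.Mem G := by
  set H := subgroupOfWords e L with hH
  have hle : V.verbalSubgroup A ≤ H := by
    rw [GroupPseudovariety.isClosedSubgroup_iff] at hcl
    rw [← hcl]
    exact V.verbalSubgroup_le_closure _
  have : H.FiniteIndex := V.finiteIndex_of_verbalSubgroup_le hA (subgroupOfWords_fg _ _) hle
  obtain ⟨M, c, S, ε, s, hM, hε, hc, hs1, hs, hS, hγ, -⟩ := exists_marked_table e H.normalCore
  have hmem : V.Mem (FreeGroup A ⧸ H.normalCore) := by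
    have : V.verbalSubgroup A ≤ (QuotientGroup.mk' H.normalCore).ker := by
      rw [QuotientGroup.ker_mk']
      exact Subgroup.normal_le_normalCore.2 hle
    refine V.image_mem _ _ (QuotientGroup.lift _ _ this) ?_ (V.mem_quotient_verbalSubgroup A)
    exact QuotientGroup.lift_surjective_of_surjective _ _ (QuotientGroup.mk'_surjective _) _
  set L' : List GroupWord := L.map fun w => w.map fun x => ((x.1 : ℕ), x.2) with hL'
  -- The bounds stand inside the existential so that `choose` yields a function of `a` and `i`
  -- alone.
  have hq : ∀ (a i : ℕ), ∃ q, a < n → i < M.length → IsFactorization L' q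
      (invRev (S.getD (entry M (letterIndex (ε 1) c (a, true)) i) []) ++
        (a, true) :: S.getD i []) := by
    intro a i
    by_cases ha : a < n
    swap
    · exact ⟨[], fun h => absurd h ha⟩
    by_cases hi : i < M.length
    swap
    · exact ⟨[], fun _ h => absurd h hi⟩
    obtain ⟨g, rfl⟩ := exists_eq_of_lt ε hi
    obtain ⟨q, hq⟩ := (exists_isFactorization_iff L' (invRev (S.getD
      (entry M (letterIndex (ε 1) c (a, true)) (ε g)) []) ++ (a, true) :: S.getD (ε g) [])).2 (by
        rw [hL', closure_mk_eq_map_toNatLetters e, ← hH, hγ ⟨a, ha⟩, hε.entry_eq, hS, hS]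
        set g' := QuotientGroup.mk' H.normalCore (of (e ⟨a, ha⟩)) * g with hg'
        refine ⟨(s g')⁻¹ * (of (e ⟨a, ha⟩) * s g), ?_, ?_⟩
        · refine H.normalCore_le ?_
          rw [← QuotientGroup.ker_mk' H.normalCore, MonoidHom.mem_ker]
          rw [_root_.map_mul, _root_.map_mul, _root_.map_inv, hs, hs, hg', inv_mul_cancel]
        · have hcons : ∀ w : GroupWord, FreeGroup.mk ((a, true) :: w) = of a * FreeGroup.mk w := fun w => by
            simp [of, mul_mk]
          rw [← mul_mk, hcons, ← inv_mk, mk_toWord, mk_toWord]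
          simp)
    exact ⟨q, fun _ _ => hq⟩
  choose q hq using hq
  refine ⟨M, ε 1, c, S, (List.range n).flatMap fun a => (List.range M.length).map (q a),
    hε.isGroupTable hM, hc, ⟨by rw [hS, hs1, _root_.map_one, toWord_one], fun a ha i hi =>
      ⟨q a i, ?_, hq a i ha hi⟩⟩, (V.exists_mem_of_isMulTable_iff hM hε).2 hmem⟩
  exact List.mem_flatMap.2 ⟨a, List.mem_range.2 ha, List.mem_map.2 ⟨i, List.mem_range.2 hi, rfl⟩⟩

/-- Completeness of negative certificates: if `F_A/core(P)` were in `V` for every `P ≥ H` of finite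
index, Hall's theorem would make `H` closed. For a bad `P`, the set `J` is the image of `P` in
`F_A/core(P)`, which has trivial core. -/
theorem exists_isCoreFree (L : List (List (Fin n × Bool)))
    (hcl : ¬ V.finiteTrace.IsClosedSubgroup (subgroupOfWords e L)) :
    ∃ (M : List (List ℕ)) (z : ℕ) (c : List (ℕ × ℕ)) (S : List GroupWord)
      (J : List ℕ), IsGroupTable M z ∧ IsMarking n M z c ∧
      IsCoreFree (L.map fun w => w.map fun x => ((x.1 : ℕ), x.2)) M z c S J ∧
      ¬ ∃ (G : Type u) (_ : Group G),
        GroupPseudovariety.IsMulTable M G ∧ V.finiteTrace.Mem G := by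
  classical
  set H := subgroupOfWords e L with hH
  obtain ⟨P, hPfin, hHP, hmem⟩ : ∃ P : Subgroup (FreeGroup A), P.FiniteIndex ∧ H ≤ P ∧
      ¬ V.Mem (FreeGroup A ⧸ P.normalCore) := by
    by_contra! hcon
    refine hcl ((GroupPseudovariety.isClosedSubgroup_iff _ _).2
      (GroupPseudovariety.closure_eq_of_exists _ fun x hx => ?_))
    obtain ⟨P, hP, hHP, hxP⟩ := exists_finiteIndex_notMem (subgroupOfWords_fg e L) hx
    exact ⟨P, hHP, hxP, hcon P hP hHP, inferInstanceAs (Finite (FreeGroup A ⧸ P.normalCore))⟩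
  obtain ⟨M, c, S, ε, s, hM, hε, hc, hs1, hs, hS, -, hact⟩ := exists_marked_table e P.normalCore
  set π := QuotientGroup.mk' P.normalCore with hπ
  have hSw : ∀ g, π (ofNatLetters e (FreeGroup.mk (S.getD (ε g) []))) = g := fun g => by
    rw [hS, mk_toWord, ofNatLetters_toNatLetters, hs]
  have hact1 : ∀ w, act M (ε 1) c w (ε 1) = ε (π (ofNatLetters e (FreeGroup.mk w))) := fun w => by
    rw [hact, mul_one]
  let J : List ℕ := (List.range M.length).filter fun j => ∃ h ∈ P, (ε (π h) : ℕ) = j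
  have hJ : ∀ x, (ε (π x) : ℕ) ∈ J ↔ x ∈ P := by
    intro x
    simp only [J, List.mem_filter, List.mem_range, decide_eq_true_eq, Fin.val_inj,
      ε.apply_eq_iff_eq]
    refine ⟨?_, fun hx => ⟨(ε (π x)).2, x, hx, rfl⟩⟩
    rintro ⟨-, h, hh, hx⟩
    have : h⁻¹ * x ∈ P := P.normalCore_le (QuotientGroup.eq.1 hx)
    simpa using P.mul_mem hh this
  have hw : ∀ w ∈ L.map fun w => w.map fun x => ((x.1 : ℕ), x.2),
      ofNatLetters e (FreeGroup.mk w) ∈ P := by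
    intro w hw
    apply hHP
    rw [hH, subgroupOfWords_eq_map_ofNatLetters]
    exact Subgroup.mem_map_of_mem _ (Subgroup.subset_closure ⟨w, hw, rfl⟩)
  have hJsurj : ∀ j ∈ J, ∃ x ∈ P, (ε (π x) : ℕ) = j := by
    intro j hj
    simpa using (List.mem_filter.1 hj).2
  refine ⟨M, ε 1, c, S, J, hε.isGroupTable hM, hc, ⟨fun i hi => ?_, ?_, fun w hwL j hj => ?_,
    fun i hi => ?_⟩, fun h => hmem ((V.exists_mem_of_isMulTable_iff hM hε).1 h)⟩
  · obtain ⟨g, rfl⟩ := exists_eq_of_lt ε hi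
    rw [hact1, hSw]
  · rw [← _root_.map_one π, hJ]
    exact one_mem P
  · obtain ⟨x, hx, rfl⟩ := hJsurj j hj
    rw [hact, hact, ← _root_.map_mul, ← _root_.map_mul, hJ, hJ, ← inv_mk, _root_.map_inv]
    exact ⟨mul_mem (hw w hwL) hx, mul_mem (inv_mem (hw w hwL)) hx⟩
  · obtain ⟨g, rfl⟩ := exists_eq_of_lt ε hi
    obtain ⟨x, rfl⟩ := QuotientGroup.mk'_surjective P.normalCore g
    by_cases hx : x ∈ P.normalCore
    · left
      have : π x = 1 := (QuotientGroup.eq_one_iff x).2 hx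
      rw [← hπ, this]
    right
    obtain ⟨b, hb⟩ : ∃ b, b * x * b⁻¹ ∉ P := by
      by_contra! hcon
      exact hx hcon
    refine ⟨ε (π b⁻¹), (ε _).2, ?_⟩
    rw [hact1, ← mul_mk, ← mul_mk, ← inv_mk, _root_.map_mul (ofNatLetters e),
      _root_.map_mul (ofNatLetters e), _root_.map_inv (ofNatLetters e), _root_.map_mul π,
      _root_.map_mul π, _root_.map_inv π, hSw, hSw, ← hπ, ← _root_.map_inv π, ← _root_.map_mul π,
      ← _root_.map_mul π, hJ, inv_inv, ← mul_assoc]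
    exact hb

end GroupVariety

-- Primitive recursiveness of the certificate checks

attribute [fun_prop] Primrec
attribute [fun_prop] Primrec.id Primrec.const Primrec.comp Primrec.fst Primrec.snd Primrec.pair
  Primrec.list_length

section

variable {α β σ : Type*} [Primcodable α] [Primcodable β] [Primcodable σ]

namespace PrimrecPred

theorem forall_mem {f : α → List β} (hf : Primrec f) {R : α → β → Prop}
    (hR : PrimrecPred fun p : α × β => R p.1 p.2) : PrimrecPred fun x => ∀ b ∈ f x, R x b := by
  have h : PrimrecRel fun (b : β) (x : α) => R x b :=
    hR.comp (Primrec.snd.pair Primrec.fst)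
  exact h.forall_mem_list.comp hf Primrec.id

theorem exists_mem {f : α → List β} (hf : Primrec f) {R : α → β → Prop}
    (hR : PrimrecPred fun p : α × β => R p.1 p.2) : PrimrecPred fun x => ∃ b ∈ f x, R x b := by
  have h : PrimrecRel fun (b : β) (x : α) => R x b :=
    hR.comp (Primrec.snd.pair Primrec.fst)
  exact h.exists_mem_list.comp hf Primrec.id

theorem forall_lt' {f : α → ℕ} (hf : Primrec f) {R : α → ℕ → Prop}
    (hR : PrimrecPred fun p : α × ℕ => R p.1 p.2) : PrimrecPred fun x => ∀ b < f x, R x b :=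
  (forall_mem (Primrec.list_range.comp hf) hR).of_eq fun x => by simp

theorem exists_lt' {f : α → ℕ} (hf : Primrec f) {R : α → ℕ → Prop}
    (hR : PrimrecPred fun p : α × ℕ => R p.1 p.2) : PrimrecPred fun x => ∃ b < f x, R x b :=
  (exists_mem (Primrec.list_range.comp hf) hR).of_eq fun x => by simp

theorem mem_list {f : α → List β} {g : α → β} (hf : Primrec f) (hg : Primrec g) :
    PrimrecPred fun x => g x ∈ f x :=
  (exists_mem hf (R := fun x b => b = g x) (Primrec.eq.comp Primrec.snd
    (hg.comp Primrec.fst))).of_eq fun x => by simp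

theorem eq' {f g : α → β} (hf : Primrec f) (hg : Primrec g) : PrimrecPred fun x => f x = g x :=
  Primrec.eq.comp hf hg

theorem lt' {f g : α → ℕ} (hf : Primrec f) (hg : Primrec g) : PrimrecPred fun x => f x < g x :=
  Primrec.nat_lt.comp hf hg

theorem le' {f g : α → ℕ} (hf : Primrec f) (hg : Primrec g) : PrimrecPred fun x => f x ≤ g x :=
  Primrec.nat_le.comp hf hg

end PrimrecPred

namespace Primrec

@[fun_prop]
theorem cons' {f : α → β} {g : α → List β} (hf : Primrec f) (hg : Primrec g) :
    Primrec fun x => f x :: g x :=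
  list_cons.comp hf hg

@[fun_prop]
theorem append' {f g : α → List β} (hf : Primrec f) (hg : Primrec g) :
    Primrec fun x => f x ++ g x :=
  list_append.comp hf hg

@[fun_prop]
theorem flatten' {f : α → List (List β)} (hf : Primrec f) : Primrec fun x => (f x).flatten :=
  list_flatten.comp hf

@[fun_prop]
theorem getD' {f : α → List β} {g : α → ℕ} {h : α → β} (hf : Primrec f) (hg : Primrec g)
    (hh : Primrec h) : Primrec fun x => (f x).getD (g x) (h x) := by
  simp only [List.getD_eq_getElem?_getD]
  exact option_getD.comp (list_getElem?.comp hf hg) hh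

@[fun_prop]
theorem entry' {f : α → List (List ℕ)} {g h : α → ℕ} (hf : Primrec f) (hg : Primrec g)
    (hh : Primrec h) : Primrec fun x => entry (f x) (g x) (h x) := by
  unfold entry
  fun_prop

@[fun_prop]
theorem letterIndex' {f : α → ℕ} {g : α → List (ℕ × ℕ)} {h : α → ℕ × Bool} (hf : Primrec f)
    (hg : Primrec g) (hh : Primrec h) : Primrec fun x => letterIndex (f x) (g x) (h x) := by
  unfold letterIndex
  exact cond (by fun_prop) (by fun_prop) (by fun_prop)

@[fun_prop]
theorem act' {M : α → List (List ℕ)} {z : α → ℕ} {c : α → List (ℕ × ℕ)} {w : α → GroupWord}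
    {i : α → ℕ} (hM : Primrec M) (hz : Primrec z) (hc : Primrec c) (hw : Primrec w)
    (hi : Primrec i) : Primrec fun x => act (M x) (z x) (c x) (w x) (i x) := by
  unfold act
  exact list_foldr (h := fun x p => entry (M x) (letterIndex (z x) (c x) p.1) p.2) hw hi
    (by unfold Primrec₂; fun_prop)

@[fun_prop]
theorem invRev' {w : α → GroupWord} (hw : Primrec w) : Primrec fun x => invRev (w x) := by
  unfold invRev
  refine list_reverse.comp (list_map hw ?_)
  exact Primrec.pair (by fun_prop) (Primrec.not.comp (by fun_prop))

@[fun_prop]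
theorem reduce' {w : α → GroupWord} (hw : Primrec w) : Primrec fun x => reduce (w x) := by
  -- Free reduction is a right fold that cancels each new letter against the head of the reduced
  -- tail.
  let step (p : (ℕ × Bool) × GroupWord) : GroupWord :=
    List.casesOn p.2 [p.1] fun hd tl =>
      if p.1.1 = hd.1 ∧ p.1.2 = !hd.2 then tl else p.1 :: hd :: tl
  have hstep : Primrec step := by
    refine list_casesOn (h := fun (p : (ℕ × Bool) × GroupWord) (q : (ℕ × Bool) × GroupWord) =>
      if p.1.1 = q.1.1 ∧ p.1.2 = !q.1.2 then q.2 else p.1 :: q.1 :: q.2) (by fun_prop) (by fun_prop)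
      ?_
    refine Primrec.ite ?_ ?_ ?_
    · exact (PrimrecPred.eq' (by fun_prop) (by fun_prop)).and
        (PrimrecPred.eq' (by fun_prop) (Primrec.not.comp (by fun_prop)))
    · fun_prop
    · fun_prop
  have : ∀ l : GroupWord, reduce l = l.foldr (fun b s => step (b, s)) [] := by
    intro l
    induction l with
    | nil => rfl
    | cons p l ih => rw [reduce.cons, ih]; rfl
  simp only [this]
  exact list_foldr (h := fun _ p => step p) hw (by fun_prop)
    (by unfold Primrec₂; exact hstep.comp Primrec.snd)

end Primrec

namespace PrimrecPred

theorem isGroupTable {M : α → List (List ℕ)} {z : α → ℕ} (hM : Primrec M) (hz : Primrec z) :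
    PrimrecPred fun x => IsGroupTable (M x) (z x) := by
  unfold IsGroupTable
  refine .and (forall_mem hM (eq' ?_ ?_)) <| .and (lt' hz ?_) <| .and (forall_lt' ?_ ?_) <|
    forall_lt' ?_ <| forall_lt' ?_ <| .and (lt' ?_ ?_) <| forall_lt' ?_ <| eq' ?_ ?_
  case refine_5 =>
    exact .and (eq' (by fun_prop) (by fun_prop)) <| exists_lt' (by fun_prop) <|
      eq' (by fun_prop) (by fun_prop)
  all_goals fun_prop

theorem isMarking {n : α → ℕ} {M : α → List (List ℕ)} {z : α → ℕ} {c : α → List (ℕ × ℕ)}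
    (hn : Primrec n) (hM : Primrec M) (hz : Primrec z) (hc : Primrec c) :
    PrimrecPred fun x => IsMarking (n x) (M x) (z x) (c x) := by
  unfold IsMarking
  refine (le' ?_ hn).and <| forall_mem hc <| (lt' ?_ ?_).and <| (lt' ?_ ?_).and <| eq' ?_ ?_
  all_goals fun_prop

theorem isFactorization {L q : α → List GroupWord} {w : α → GroupWord} (hL : Primrec L)
    (hq : Primrec q) (hw : Primrec w) : PrimrecPred fun x => IsFactorization (L x) (q x) (w x) := by
  unfold IsFactorization
  refine (forall_mem hq <| (mem_list ?_ ?_).or <| mem_list ?_ ?_).and <| eq' ?_ ?_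
  all_goals fun_prop

theorem isSchreierSystem {n : α → ℕ} {L : α → List GroupWord} {M : α → List (List ℕ)} {z : α → ℕ}
    {c : α → List (ℕ × ℕ)} {S : α → List GroupWord} {Q : α → List (List GroupWord)}
    (hn : Primrec n) (hL : Primrec L) (hM : Primrec M) (hz : Primrec z) (hc : Primrec c)
    (hS : Primrec S) (hQ : Primrec Q) :
    PrimrecPred fun x => IsSchreierSystem (n x) (L x) (M x) (z x) (c x) (S x) (Q x) := by
  unfold IsSchreierSystem
  refine (eq' ?_ ?_).and <| forall_lt' hn <| forall_lt' ?_ <| exists_mem ?_ <|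
    isFactorization ?_ ?_ ?_
  all_goals fun_prop

theorem isCoreFree {L : α → List GroupWord} {M : α → List (List ℕ)} {z : α → ℕ}
    {c : α → List (ℕ × ℕ)} {S : α → List GroupWord} {J : α → List ℕ}
    (hL : Primrec L) (hM : Primrec M) (hz : Primrec z) (hc : Primrec c)
    (hS : Primrec S) (hJ : Primrec J) :
    PrimrecPred fun x => IsCoreFree (L x) (M x) (z x) (c x) (S x) (J x) := by
  unfold IsCoreFree
  refine .and (forall_lt' ?_ ?_) <| .and (mem_list hJ hz) <|
    .and (forall_mem hL <| forall_mem ?_ <| .and (mem_list ?_ ?_) <| mem_list ?_ ?_) <|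
    forall_lt' ?_ <| .or (eq' ?_ ?_) <| exists_lt' ?_ <| .not (mem_list ?_ ?_)
  case refine_2 => exact eq' (by fun_prop) (by fun_prop)
  all_goals fun_prop

end PrimrecPred

/-- Unbounded search, total because `h` guarantees that it halts. -/
theorem Computable.exists_of_option {g : α → ℕ → Option σ} (hg : Computable₂ g)
    (h : ∀ x, ∃ k b, g x k = some b) :
    ∃ f : α → σ, Computable f ∧ ∀ x, ∃ k, g x k = some (f x) := by
  have hdom : ∀ x, (Nat.rfindOpt (g x)).Dom := fun x => Nat.rfindOpt_dom.2 (h x)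
  refine ⟨fun x => (Nat.rfindOpt (g x)).get (hdom x),
    (Partrec.rfindOpt hg).of_eq_tot fun x => Part.get_mem _, fun x => ?_⟩
  exact Nat.rfindOpt_spec (Part.get_mem (hdom x))

end

/-! ### The decision algorithms -/

namespace GroupVariety

variable (V : GroupVariety.{u})

theorem exists_map_finVal_eq {n : ℕ} {L : List GroupWord} (hL : ∀ w ∈ L, ∀ p ∈ w, p.1 < n) :
    ∃ L' : List (List (Fin n × Bool)),
      L'.map (fun w => w.map fun x => ((x.1 : ℕ), x.2)) = L := by
  have h : L ∈ Set.range
      (List.map fun w : List (Fin n × Bool) => w.map fun x => ((x.1 : ℕ), x.2)) := by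
    rw [Set.range_list_map]
    intro w hw
    change w ∈ Set.range (List.map fun x : Fin n × Bool => ((x.1 : ℕ), x.2))
    rw [Set.range_list_map]
    exact fun p hp => ⟨(⟨p.1, hL w hw p hp⟩, p.2), rfl⟩
  exact h

theorem verbalSubgroup_ne_bot_of_le {m n : ℕ} {A : Type u} (e : Fin n ≃ A) (hmn : m ≤ n)
    (hm : V.verbalSubgroup (ULift.{u} (Fin m)) ≠ ⊥) : V.verbalSubgroup A ≠ ⊥ := by
  refine V.verbalSubgroup_ne_bot_of_injective
    (fun i : ULift.{u} (Fin m) => e (Fin.castLE hmn i.down)) (fun i j h => ?_) hm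
  exact ULift.down_injective (Fin.castLE_injective hmn (e.injective h))

/-- The data that certify that a subgroup is closed or that it is not. -/
abbrev Certificate :=
  List (List ℕ) × ℕ × List (ℕ × ℕ) × List GroupWord × List (List GroupWord) × List ℕ

/-- There is an algorithm that decides closedness on alphabets with at least `m` letters, provided
that the free group of rank `m` is not relatively free. -/
theorem exists_computable_of_verbalSubgroup_ne_bot (hdec : V.finiteTrace.IsDecidable) {m : ℕ}
    (hm : V.verbalSubgroup (ULift.{u} (Fin m)) ≠ ⊥) :
    ∃ f : ℕ × List GroupWord → Bool, Computable f ∧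
      ∀ (n : ℕ) (A : Type u) (e : Fin n ≃ A) (L : List (List (Fin n × Bool))), m ≤ n →
        (f (n, L.map fun w => w.map fun x => ((x.1 : ℕ), x.2)) = true ↔
          V.finiteTrace.IsClosedSubgroup (subgroupOfWords e L)) := by
  classical
  obtain ⟨d, hd, hdM⟩ := ComputablePred.computable_iff.1 hdec
  have hdM : ∀ M, (∃ (G : Type u) (_ : Group G), GroupPseudovariety.IsMulTable M G ∧
      V.finiteTrace.Mem G) ↔ d M = true := fun M => by
    have := congrFun hdM M
    simpa using this
  -- Inputs of too small rank or with letters out of range get the arbitrary answer `true`, so that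
  -- the search halts on every input.
  let bad (x : ℕ × List GroupWord) : Prop := ¬ (m ≤ x.1 ∧ ∀ w ∈ x.2, ∀ p ∈ w, p.1 < x.1)
  let yes (x : (ℕ × List GroupWord) × Certificate) : Prop :=
    (IsGroupTable x.2.1 x.2.2.1 ∧ IsMarking x.1.1 x.2.1 x.2.2.1 x.2.2.2.1) ∧
    IsSchreierSystem x.1.1 x.1.2 x.2.1 x.2.2.1 x.2.2.2.1 x.2.2.2.2.1 x.2.2.2.2.2.1
  let no (x : (ℕ × List GroupWord) × Certificate) : Prop :=
    (IsGroupTable x.2.1 x.2.2.1 ∧ IsMarking x.1.1 x.2.1 x.2.2.1 x.2.2.2.1) ∧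
    IsCoreFree x.1.2 x.2.1 x.2.2.1 x.2.2.2.1 x.2.2.2.2.1 x.2.2.2.2.2.2
  have hbad : PrimrecPred bad :=
    .not <| .and (.le' (by fun_prop) (by fun_prop)) <| .forall_mem (by fun_prop) <|
      .forall_mem (by fun_prop) <| .lt' (by fun_prop) (by fun_prop)
  have htab : PrimrecPred fun x : (ℕ × List GroupWord) × Certificate =>
      IsGroupTable x.2.1 x.2.2.1 ∧ IsMarking x.1.1 x.2.1 x.2.2.1 x.2.2.2.1 :=
    .and (.isGroupTable (by fun_prop) (by fun_prop))
      (.isMarking (by fun_prop) (by fun_prop) (by fun_prop) (by fun_prop))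
  have hyes : PrimrecPred yes :=
    .and htab (.isSchreierSystem (by fun_prop) (by fun_prop) (by fun_prop) (by fun_prop)
      (by fun_prop) (by fun_prop) (by fun_prop))
  have hno : PrimrecPred no :=
    .and htab (.isCoreFree (by fun_prop) (by fun_prop) (by fun_prop) (by fun_prop)
      (by fun_prop) (by fun_prop))
  let out (x : (ℕ × List GroupWord) × Certificate) : Option Bool :=
    bif decide (bad x.1) then some true else
    bif decide (yes x) && d x.2.1 then some true else
    bif decide (no x) && !d x.2.1 then some false else none
  have hd' : Computable fun x : (ℕ × List GroupWord) × Certificate => d x.2.1 :=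
    hd.comp (Primrec.fst.comp Primrec.snd).to_comp
  have hout : Computable out :=
    .cond (hbad.decide.to_comp.comp .fst) (.const _) <|
      .cond (Primrec.and.to_comp.comp hyes.decide.to_comp hd') (.const _) <|
        .cond (Primrec.and.to_comp.comp hno.decide.to_comp (Primrec.not.to_comp.comp hd'))
          (.const _) (.const _)
  have hg : Computable₂ fun (x : ℕ × List GroupWord) (k : ℕ) =>
      (Encodable.decode (α := Certificate) k).bind fun p => out (x, p) :=
    Computable.option_bind (Computable.decode.comp .snd)
      (hout.comp (Computable.pair (Computable.fst.comp .fst) .snd))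
  have hsome : ∀ (x : ℕ × List GroupWord) (p : Certificate) (b : Bool), out (x, p) = some b → ∃ k b,
      (Encodable.decode (α := Certificate) k).bind (fun p => out (x, p)) = some b :=
    fun x p b h => ⟨Encodable.encode p, b, by simpa using h⟩
  have hhalt (x : ℕ × List GroupWord) : ∃ k b,
      (Encodable.decode (α := Certificate) k).bind (fun p => out (x, p)) = some b := by
    by_cases hx : bad x
    · exact hsome x default true (by simp [out, hx])
    obtain ⟨n, L₀⟩ := x
    obtain ⟨hmn, hL⟩ := not_not.1 hx
    obtain ⟨L, hL₀⟩ : ∃ L : List (List (Fin n × Bool)),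
        L.map (fun w => w.map fun x => ((x.1 : ℕ), x.2)) = L₀ := exists_map_finVal_eq hL
    subst hL₀
    -- Halting depends only on `n` and the words, so one model alphabet suffices; correctness is
    -- proved below for every alphabet.
    let e : Fin n ≃ ULift.{u} (Fin n) := Equiv.ulift.symm
    by_cases hcl : V.finiteTrace.IsClosedSubgroup (subgroupOfWords e L)
    · obtain ⟨M, z, c, S, Q, h1, h2, h3, h4⟩ := V.exists_isSchreierSystem e (V.verbalSubgroup_ne_bot_of_le e hmn hm) L hcl
      refine hsome _ (M, z, c, S, Q, []) true ?_
      simp [out, hx, yes, h1, h2, h3, (hdM M).1 h4]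
    · obtain ⟨M, z, c, S, J, h1, h2, h3, h4⟩ := V.exists_isCoreFree e L hcl
      refine hsome _ (M, z, c, S, [], J) false ?_
      rw [hdM, Bool.not_eq_true] at h4
      simp [out, hx, no, h1, h2, h3, h4]
  obtain ⟨f, hf, hfout⟩ := Computable.exists_of_option hg hhalt
  refine ⟨f, hf, fun n A e L hmn => ?_⟩
  obtain ⟨k, hk⟩ := hfout (n, L.map fun w => w.map fun x => ((x.1 : ℕ), x.2))
  obtain ⟨p, -, hp⟩ := Option.bind_eq_some_iff.1 hk
  have hgood : ¬ bad (n, L.map fun w => w.map fun x => ((x.1 : ℕ), x.2)) := by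
    refine not_not.2 ⟨hmn, fun w hw p hp => ?_⟩
    obtain ⟨w, -, rfl⟩ := List.mem_map.1 hw
    obtain ⟨p, -, rfl⟩ := List.mem_map.1 hp
    exact p.1.2
  simp only [out, hgood, ↓reduceIte, Bool.cond_eq_ite, Bool.and_eq_true,
    decide_eq_true_eq, Bool.not_eq_true'] at hp
  split_ifs at hp with h1 h2
  · rw [Option.some.injEq] at hp
    rw [← hp, eq_self_iff_true, true_iff]
    exact V.isClosedSubgroup_of_isSchreierSystem e h1.1.1.1 h1.1.1.2 h1.1.2 ((hdM _).2 h1.2)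
  · rw [Option.some.injEq] at hp
    rw [← hp]
    refine iff_of_false Bool.false_ne_true
      (V.not_isClosedSubgroup_of_isCoreFree e h2.1.1.1 h2.1.1.2 h2.1.2 ?_)
    rw [hdM, h2.2]
    exact Bool.false_ne_true

/-- Closedness of finitely generated subgroups of free groups of finite rank is uniformly decidable.
-/
theorem exists_computable_isClosedSubgroup_iff (hdec : V.finiteTrace.IsDecidable) :
    ∃ f : ℕ × List GroupWord → Bool, Computable f ∧
      ∀ (n : ℕ) (A : Type u) (e : Fin n ≃ A) (L : List (List (Fin n × Bool))),
        f (n, L.map fun w => w.map fun x => ((x.1 : ℕ), x.2)) = true ↔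
          V.finiteTrace.IsClosedSubgroup (subgroupOfWords e L) := by
  classical
  have hclosed : ∀ (n : ℕ), V.verbalSubgroup (ULift.{u} (Fin n)) = ⊥ →
      ∀ (A : Type u) (e : Fin n ≃ A) (L : List (List (Fin n × Bool))),
        V.finiteTrace.IsClosedSubgroup (subgroupOfWords e L) := by
    intro n hn A e L
    rw [GroupPseudovariety.isClosedSubgroup_iff]
    refine V.closure_finiteTrace_eq_of_verbalSubgroup_eq_bot ?_ (subgroupOfWords_fg e L)
    by_contra hA
    exact V.verbalSubgroup_ne_bot_of_injective (e.symm.trans Equiv.ulift.symm)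
      (Equiv.injective _) hA hn
  -- Nontriviality of the verbal subgroup persists as the rank grows, so the least such `m`
  -- separates the ranks where everything is closed from those needing the search. As a constant,
  -- `m` need not be computed from `V`.
  by_cases hex : ∃ m, V.verbalSubgroup (ULift.{u} (Fin m)) ≠ ⊥
  · obtain ⟨f, hf, hfspec⟩ := V.exists_computable_of_verbalSubgroup_ne_bot hdec (Nat.find_spec hex)
    have hlow : PrimrecPred fun x : ℕ × List GroupWord => x.1 < Nat.find hex :=
      .lt' (by fun_prop) (by fun_prop)
    refine ⟨fun x => decide (x.1 < Nat.find hex) || f x,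
      Primrec.or.to_comp.comp hlow.decide.to_comp hf, fun n A e L => ?_⟩
    by_cases hn : n < Nat.find hex
    · simpa [hn] using hclosed n (not_not.1 (Nat.find_min hex hn)) A e L
    · simpa only [hn, decide_false, Bool.false_or] using hfspec n A e L (not_lt.1 hn)
  · push Not at hex
    exact ⟨fun _ => true, .const _, fun n A e L => by simpa using hclosed n (hex n) A e L⟩

/-- The answer does not depend on the input: a closed finitely generated subgroup equals its
closure, which is finitely generated only if `V` is everything. A constant predicate is computable.
-/
theorem computablePred_isClosedSubgroup_of_infinite {A : Type u} (ν : ℕ ↪ A) :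
    ComputablePred fun L : List GroupWord =>
      V.finiteTrace.IsClosedSubgroup (subgroupOfWords ν L) := by
  have : Infinite A := Infinite.of_injective ν ν.injective
  have key : ∀ L : List GroupWord,
      V.finiteTrace.IsClosedSubgroup (subgroupOfWords ν L) ↔ V.IsAllGroups := by
    intro L
    have hfg := subgroupOfWords_fg ν L
    rw [GroupPseudovariety.isClosedSubgroup_iff]
    refine ⟨fun h => (V.closure_fg_iff_of_infinite hfg).1 (by rwa [h]), fun hV =>
      V.closure_finiteTrace_eq_of_isAllGroups hV hfg⟩
  have h : ComputablePred fun _ : List GroupWord => V.IsAllGroups :=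
    ⟨fun _ => Classical.dec _, Computable.const _⟩
  exact h.of_eq fun L => (key L).symm

end GroupVariety

theorem theorem3p1 {A : Type u} (V : GroupVariety.{u}) :
    (∀ H : Subgroup (FreeGroup A), H.FG →
      -- (i)
      (V.finiteTrace.closure H =
          (GroupPseudovariety.allFinite.closure (H.map (V.proj A))).comap (V.proj A) ∧
        (H : Set (FreeGroup A)) * (V.verbalSubgroup A : Set (FreeGroup A)) ⊆
          (V.finiteTrace.closure H : Set (FreeGroup A))) ∧
      -- (ii)
      (Infinite A → ((V.finiteTrace.closure H).FG ↔ V.IsAllGroups)) ∧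
      -- (iii); a degenerate case in rank one has to be excluded
      (Finite A →
        ¬ (Nat.card A = 1 ∧ H = ⊥ ∧ V.verbalSubgroup A = ⊥ ∧ ¬ V.IsAllGroups) →
        ((V.finiteTrace.closure H).FG ↔
          V.IsAllGroups ∨ (V.finiteTrace.closure H).FiniteIndex))) ∧
    -- (iv)
    (V.finiteTrace.IsDecidable →
      -- one algorithm for all finite alphabets `A'`, given by the number `n` of their letters
      (∃ f : ℕ × List (List (ℕ × Bool)) → Bool, Computable f ∧
        ∀ (n : ℕ) (A' : Type u) (e : Fin n ≃ A') (L : List (List (Fin n × Bool))),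
          f (n, L.map fun w => w.map fun x => ((x.1 : ℕ), x.2)) = true ↔
            V.finiteTrace.IsClosedSubgroup (subgroupOfWords e L)) ∧
      -- an algorithm for the given alphabet `A` when it is infinite, the words being written with
      -- an enumerated set of letters of `A`
      (∀ ν : ℕ ↪ A, ComputablePred fun L : List (List (ℕ × Bool)) =>
        V.finiteTrace.IsClosedSubgroup (subgroupOfWords ν L))) := by
  refine ⟨fun H hH => ⟨⟨V.closure_finiteTrace_eq_comap H, ?_⟩,
    fun _ => V.closure_fg_iff_of_infinite hH, fun _ => V.closure_fg_iff_of_finite hH⟩,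
    fun hdec => ⟨V.exists_computable_isClosedSubgroup_iff hdec,
      V.computablePred_isClosedSubgroup_of_infinite⟩⟩
  rintro _ ⟨h, hh, x, hx, rfl⟩
  exact mul_mem (V.finiteTrace.le_closure H hh) (V.verbalSubgroup_le_closure H hx)
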